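/- Conventions. A quantaloid is a category enriched in complete lattices and supremum-preserving maps; a homomorphism of quantaloids is a functor preserving suprema of morphisms; an involution on a quantaloid $\mathcal{Q}$ is a homomorphism $(-)^{\sf o}\colon\mathcal{Q}^{\rm op}\to\mathcal{Q}$ that is the identity on objects and satisfies $f^{\sf oo}=f$; homomorphisms of involutive quantaloids also preserve the involution. For a small site $(\mathcal{C},J)$, the quantaloid $\mathcal{R}(\mathcal{C},J)$ has the objects of $\mathcal{C}$ as objects; a morphism $X\to Y$ is a closed crible, i.e. a set $R$ of spans $X\xleftarrow{f}W\xrightarrow{g}Y$ in $\mathcal{C}$ that is stable under precomposition and contains $(f,g)$ as soon as it contains $(fk,gk)$ for all $k$ in some $J$-covering sieve on $W$. Cribles are ordered by inclusion; suprema are the closures of unions; the identity on $X$ is the closure of $\{(f,f)\}$; and the composite of $R\colon X\to Y$ and $S\colon Y\to Z$ is the closure of $\{(f,h)\mid \exists g\colon (f,g)\in R,\ (g,h)\in S\}$. A small quantaloid of closed cribles is a small quantaloid that is equivalent, as a quantaloid, to $\mathcal{R}(\mathcal{C},J)$ for some small site $(\mathcal{C},J)$. For a class $\mathcal{E}$ of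 idempotents in $\mathcal{Q}$, the quantaloid $\mathcal{Q}_{\mathcal{E}}$ has the elements of $\mathcal{E}$ as objects, and its morphisms from $e\colon A\to A$ to $f\colon B\to B$ are the $x\colon A\to B$ in $\mathcal{Q}$ with $f\circ x=x=x\circ e$; composition and suprema are as in $\mathcal{Q}$, and the identity on $e$ is $e$. If $\mathcal{Q}$ is involutive and each $e\in\mathcal{E}$ is symmetric ($e^{\sf o}=e$), then $\mathcal{Q}_{\mathcal{E}}$ is involutive, with involution computed as in $\mathcal{Q}$. If $\mathcal{E}$ contains all identities, the inclusion $\mathcal{Q}\to\mathcal{Q}_{\mathcal{E}}$ sends $x\colon A\to B$ to $x\colon 1_A\to 1_B$. For a small involutive quantaloid $\mathcal{Q}$, a symmetric $\mathcal{Q}$-category $\mathbb{A}$ consists of a set of objects $x$, each with a type $tx\in\mathcal{Q}$, and arrows $\mathbb{A}(y,x)\colon tx\to ty$ with $1_{tx}\le\mathbb{A}(x,x)$, $\mathbb{A}(z,y)\circ\mathbb{A}(y,x)\le\mathbb{A}(z,x)$ and $\mathbb{A}(x,y)=\mathbb{A}(y,x)^{\sf o}$. A distributor $\Phi\colon\mathbb{A}\to\mathbb{B}$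 consists of arrows $\Phi(y,x)\colon tx\to ty$ with $\mathbb{B}(y',y)\circ\Phi(y,x)\le\Phi(y',x)$ and $\Phi(y,x)\circ\mathbb{A}(x,x')\le\Phi(y,x')$. ${\sf SymDist}(\mathcal{Q})$ is the involutive quantaloid of symmetric $\mathcal{Q}$-categories and distributors, with elementwise order, composition $(\Psi\otimes\Phi)(z,x)=\bigvee_y\Psi(z,y)\circ\Phi(y,x)$, the distributor $\mathbb{A}$ as identity on $\mathbb{A}$, and involution $\Phi^{\sf o}(x,y)=\Phi(y,x)^{\sf o}$. A homomorphism $F\colon\mathcal{Q}\to\mathcal{Q}'$ of small involutive quantaloids induces the change of base homomorphism ${\sf SymDist}(\mathcal{Q})\to{\sf SymDist}(\mathcal{Q}')$, which applies $F$ to types, hom-arrows and elements of distributors. Theorem. Let $\mathcal{Q}$ be a small quantaloid of closed cribles. Then $\mathcal{Q}$ carries a canonical involution, which sends $q\colon Y\to X$ to $$q^{\sf o}=\bigvee\{\,g\circ f^*\mid f\colon Z\to X \text{ and } g\colon Z\to Y \text{ left adjoints in } \mathcal{Q} \text{ with } f\circ g^*\le q\,\},$$ where $f^*$ and $g^*$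 denote the right adjoints of $f$ and $g$. If $\mathcal{E}$ is any class of idempotents in $\mathcal{Q}$ that are symmetric for this involution, and $\mathcal{E}$ contains all identities, then: 1. $\mathcal{Q}_{\mathcal{E}}$ is again a small quantaloid of closed cribles, and the involution that it inherits from $\mathcal{Q}$ is its own canonical involution; 2. the change of base homomorphism ${\sf SymDist}(\mathcal{Q})\to{\sf SymDist}(\mathcal{Q}_{\mathcal{E}})$ induced by the inclusion $\mathcal{Q}\to\mathcal{Q}_{\mathcal{E}}$ is an equivalence of involutive quantaloids, i.e. it has a pseudo-inverse that is a homomorphism of involutive quantaloids, with natural isomorphisms whose components have their involute as inverse. -/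

import Mathlib

open CategoryTheory

universe v u v' u'

/-! Composition is written in diagrammatic order: `f ≫ g` is the composite `g ∘ f`. -/

/-- A quantaloid: a category enriched in complete lattices and supremum-preserving maps. -/
class Quantaloid (Q : Type u) extends Category.{v} Q where
  homLattice : ∀ X Y : Q, CompleteLattice (X ⟶ Y)
  comp_sSup : ∀ {X Y Z : Q} (f : X ⟶ Y) (S : Set (Y ⟶ Z)),
    f ≫ sSup S = sSup ((fun g => f ≫ g) '' S)
  sSup_comp : ∀ {X Y Z : Q} (S : Set (X ⟶ Y)) (g : Y ⟶ Z),
    sSup S ≫ g = sSup ((fun f => f ≫ g) '' S)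

attribute [instance, reducible] Quantaloid.homLattice

namespace Quantaloid

section Basic

variable {Q : Type u} [Quantaloid.{v} Q]

theorem comp_iSup {X Y Z : Q} {I : Sort*} (f : X ⟶ Y) (g : I → (Y ⟶ Z)) :
    f ≫ (⨆ i, g i) = ⨆ i, f ≫ g i := by
  rw [iSup, comp_sSup, ← Set.range_comp]; rfl

theorem iSup_comp {X Y Z : Q} {I : Sort*} (f : I → (X ⟶ Y)) (g : Y ⟶ Z) :
    (⨆ i, f i) ≫ g = ⨆ i, f i ≫ g := by
  rw [iSup, sSup_comp, ← Set.range_comp]; rfl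

theorem comp_mono {X Y Z : Q} {f f' : X ⟶ Y} {g g' : Y ⟶ Z} (hf : f ≤ f') (hg : g ≤ g') :
    f ≫ g ≤ f' ≫ g' := by
  have h1 : f ≫ g ≤ f ≫ g' := by
    have h := comp_sSup f {g, g'}
    rw [sSup_pair, sup_eq_right.2 hg] at h
    rw [h]
    exact le_sSup ⟨g, by simp, rfl⟩
  have h2 : f ≫ g' ≤ f' ≫ g' := by
    have h := sSup_comp {f, f'} g'
    rw [sSup_pair, sup_eq_right.2 hf] at h
    rw [h]
    exact le_sSup ⟨f, by simp, rfl⟩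
  exact h1.trans h2

/-- `f` is left adjoint to `g`. -/
def IsAdj {X Y : Q} (f : X ⟶ Y) (g : Y ⟶ X) : Prop :=
  𝟙 X ≤ f ≫ g ∧ g ≫ f ≤ 𝟙 Y

/-- For `q : Y ⟶ X`, the supremum of all `g ∘ f^*`, where `f : Z ⟶ X` and `g : Z ⟶ Y` are left
adjoints (with right adjoints `f^*` and `g^*`) such that `f ∘ g^* ≤ q`. -/
def spanInvolute {X Y : Q} (q : Y ⟶ X) : X ⟶ Y :=
  sSup {r | ∃ (Z : Q) (f : Z ⟶ X) (f' : X ⟶ Z) (g : Z ⟶ Y) (g' : Y ⟶ Z),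
    IsAdj f f' ∧ IsAdj g g' ∧ g' ≫ f ≤ q ∧ r = f' ≫ g}

end Basic

/-- An involution on a quantaloid: a homomorphism `Qᵒᵖ ⟶ Q` of quantaloids which is the identity
on objects and its own inverse on morphisms. -/
structure Involution (Q : Type u) [Quantaloid.{v} Q] where
  inv : ∀ {X Y : Q}, (X ⟶ Y) → (Y ⟶ X)
  inv_id : ∀ X : Q, inv (𝟙 X) = 𝟙 X
  inv_comp : ∀ {X Y Z : Q} (f : X ⟶ Y) (g : Y ⟶ Z), inv (f ≫ g) = inv g ≫ inv f
  inv_sSup : ∀ {X Y : Q} (S : Set (X ⟶ Y)), inv (sSup S) = sSup (inv '' S)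
  inv_inv : ∀ {X Y : Q} (f : X ⟶ Y), inv (inv f) = f

namespace Involution

variable {Q : Type u} [Quantaloid.{v} Q] (ι : Involution Q)

theorem inv_iSup {X Y : Q} {I : Sort*} (f : I → (X ⟶ Y)) :
    ι.inv (⨆ i, f i) = ⨆ i, ι.inv (f i) := by
  rw [iSup, ι.inv_sSup, ← Set.range_comp]; rfl

theorem inv_mono {X Y : Q} {f g : X ⟶ Y} (h : f ≤ g) : ι.inv f ≤ ι.inv g := by
  have h' := ι.inv_sSup {f, g}
  rw [sSup_pair, sup_eq_right.2 h] at h'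
  rw [h']
  exact le_sSup ⟨f, by simp, rfl⟩

/-- The involution is the one which is given by spans of left adjoints. -/
def IsCanonical : Prop :=
  ∀ {X Y : Q} (q : Y ⟶ X), ι.inv q = spanInvolute q

end Involution

/-! ### Homomorphisms and equivalences -/

/-- A homomorphism of quantaloids. -/
structure Homomorphism (Q : Type u) (R : Type u') [Quantaloid.{v} Q] [Quantaloid.{v'} R]
    extends Q ⥤ R where
  map_sSup : ∀ {X Y : Q} (S : Set (X ⟶ Y)), map (sSup S) = sSup (map '' S)

theorem Homomorphism.map_iSup {Q : Type u} {R : Type u'} [Quantaloid.{v} Q] [Quantaloid.{v'} R]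
    (F : Homomorphism Q R) {X Y : Q} {I : Sort*} (f : I → (X ⟶ Y)) :
    F.map (⨆ i, f i) = ⨆ i, F.map (f i) := by
  rw [iSup, F.map_sSup, ← Set.range_comp]; rfl

theorem Homomorphism.map_mono {Q : Type u} {R : Type u'} [Quantaloid.{v} Q] [Quantaloid.{v'} R]
    (F : Homomorphism Q R) {X Y : Q} {f g : X ⟶ Y} (h : f ≤ g) : F.map f ≤ F.map g := by
  have h' := F.map_sSup {f, g}
  rw [sSup_pair, sup_eq_right.2 h] at h'
  rw [h']
  exact le_sSup ⟨f, by simp, rfl⟩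

/-- A homomorphism of quantaloids is an equivalence when it has a pseudo-inverse. -/
def Homomorphism.IsEquivalence {Q : Type u} {R : Type u'} [Quantaloid.{v} Q] [Quantaloid.{v'} R]
    (F : Homomorphism Q R) : Prop :=
  ∃ G : Homomorphism R Q, Nonempty (𝟭 Q ≅ F.toFunctor ⋙ G.toFunctor) ∧
    Nonempty (G.toFunctor ⋙ F.toFunctor ≅ 𝟭 R)

/-- A homomorphism of involutive quantaloids. -/
structure InvHomomorphism {Q : Type u} {R : Type u'} [Quantaloid.{v} Q] [Quantaloid.{v'} R]
    (ι : Involution Q) (κ : Involution R) extends Homomorphism Q R where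
  map_inv : ∀ {X Y : Q} (f : X ⟶ Y), map (ι.inv f) = κ.inv (map f)

/-- A homomorphism of involutive quantaloids is an equivalence when it has a pseudo-inverse which
is a homomorphism of involutive quantaloids too, such that the components of the two natural
isomorphisms are symmetric, i.e. have their involute as inverse. -/
def InvHomomorphism.IsEquivalence {Q : Type u} {R : Type u'} [Quantaloid.{v} Q] [Quantaloid.{v'} R]
    {ι : Involution Q} {κ : Involution R} (F : InvHomomorphism ι κ) : Prop :=
  ∃ (G : InvHomomorphism κ ι) (η : 𝟭 Q ≅ F.toFunctor ⋙ G.toFunctor)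
    (ε : G.toFunctor ⋙ F.toFunctor ≅ 𝟭 R),
    (∀ X : Q, ι.inv (η.hom.app X) = η.inv.app X) ∧
    (∀ Y : R, κ.inv (ε.hom.app Y) = ε.inv.app Y)

end Quantaloid

open Quantaloid

/-! ### The quantaloid of closed cribles in a site -/

section Cribles

variable {C : Type u} [Category.{v} C]

/-- A crible from `X` to `Y`: a set of spans from `X` to `Y` which is closed under precomposition
with arbitrary morphisms. -/
@[ext]
structure Crible (X Y : C) where
  rel : ∀ {W : C}, (W ⟶ X) → (W ⟶ Y) → Prop
  precomp : ∀ {V W : C} (h : V ⟶ W) {f : W ⟶ X} {g : W ⟶ Y},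
    rel f g → rel (h ≫ f) (h ≫ g)

namespace Crible

instance (X Y : C) : PartialOrder (Crible X Y) where
  le R S := ∀ ⦃W : C⦄ (f : W ⟶ X) (g : W ⟶ Y), R.rel f g → S.rel f g
  le_refl _ _ _ _ h := h
  le_trans _ _ _ h h' _ f g hfg := h' f g (h f g hfg)
  le_antisymm R S h h' := by
    ext W f g
    exact ⟨h f g, h' f g⟩

theorem le_def {X Y : C} {R S : Crible X Y} :
    R ≤ S ↔ ∀ ⦃W : C⦄ (f : W ⟶ X) (g : W ⟶ Y), R.rel f g → S.rel f g := Iff.rfl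

/-- The spans `(f, f)`. -/
def id (X : C) : Crible X X where
  rel f g := f = g
  precomp := by rintro V W h f _ rfl; rfl

/-- The spans `(f, h)` for which there is some `g` with `(f, g)` in `R` and `(g, h)` in `S`. -/
def comp {X Y Z : C} (R : Crible X Y) (S : Crible Y Z) : Crible X Z where
  rel f h := ∃ g, R.rel f g ∧ S.rel g h
  precomp := by
    rintro V W k f h ⟨g, hR, hS⟩
    exact ⟨k ≫ g, R.precomp k hR, S.precomp k hS⟩

/-- The union of a set of cribles. -/
def sUnion {X Y : C} (𝓡 : Set (Crible X Y)) : Crible X Y where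
  rel f g := ∃ R ∈ 𝓡, R.rel f g
  precomp := by
    rintro V W k f g ⟨R, hR, h⟩
    exact ⟨R, hR, R.precomp k h⟩

variable (J : GrothendieckTopology C)

/-- A crible is closed when it contains every span which belongs to it locally. -/
def IsClosed {X Y : C} (R : Crible X Y) : Prop :=
  ∀ ⦃W : C⦄ (f : W ⟶ X) (g : W ⟶ Y), ∀ T ∈ J W,
    (∀ ⦃V : C⦄ (k : V ⟶ W), T k → R.rel (k ≫ f) (k ≫ g)) → R.rel f g

/-- The smallest closed crible which contains a given one: the spans which belong to it locally. -/
def close {X Y : C} (R : Crible X Y) : Crible X Y where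
  rel {W} f g := ∃ T ∈ J W, ∀ ⦃V : C⦄ (k : V ⟶ W), T k → R.rel (k ≫ f) (k ≫ g)
  precomp := by
    rintro V W h f g ⟨T, hT, H⟩
    refine ⟨T.pullback h, J.pullback_stable h hT, fun U k hk => ?_⟩
    simpa using H (k ≫ h) hk

theorem le_close {X Y : C} (R : Crible X Y) : R ≤ R.close J :=
  fun _ _ _ h => ⟨⊤, J.top_mem _, fun _ k _ => R.precomp k h⟩

theorem close_isClosed {X Y : C} (R : Crible X Y) : (R.close J).IsClosed J := by
  intro W f g T hT H
  refine ⟨⟨fun V k => R.rel (k ≫ f) (k ≫ g), ?_⟩, ?_, fun V k hk => hk⟩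
  · intro V U k hk h
    simpa using R.precomp h hk
  · refine J.transitive hT _ fun V k hk => ?_
    obtain ⟨T', hT', H'⟩ := H k hk
    refine J.superset_covering ?_ hT'
    intro U h hh
    simpa using H' h hh

theorem close_le {X Y : C} {R S : Crible X Y} (hS : S.IsClosed J) (h : R ≤ S) :
    R.close J ≤ S := by
  rintro W f g ⟨T, hT, H⟩
  exact hS f g T hT fun V k hk => h _ _ (H k hk)

theorem close_mono {X Y : C} {R S : Crible X Y} (h : R ≤ S) : R.close J ≤ S.close J :=
  close_le J (close_isClosed J S) (h.trans (le_close J S))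

theorem close_eq {X Y : C} {R : Crible X Y} (hR : R.IsClosed J) : R.close J = R :=
  le_antisymm (close_le J hR le_rfl) (le_close J R)

theorem comp_mono {X Y Z : C} {R R' : Crible X Y} {S S' : Crible Y Z} (h : R ≤ R')
    (h' : S ≤ S') : R.comp S ≤ R'.comp S' := by
  rintro W f k ⟨g, hR, hS⟩
  exact ⟨g, h _ _ hR, h' _ _ hS⟩

theorem close_comp_le {X Y Z : C} (R : Crible X Y) (S : Crible Y Z) :
    (R.close J).comp S ≤ (R.comp S).close J := by
  rintro W f h ⟨g, ⟨T, hT, H⟩, hS⟩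
  exact ⟨T, hT, fun V k hk => ⟨k ≫ g, H k hk, S.precomp k hS⟩⟩

theorem comp_close_le {X Y Z : C} (R : Crible X Y) (S : Crible Y Z) :
    R.comp (S.close J) ≤ (R.comp S).close J := by
  rintro W f h ⟨g, hR, ⟨T, hT, H⟩⟩
  exact ⟨T, hT, fun V k hk => ⟨k ≫ g, R.precomp k hR, H k hk⟩⟩

theorem close_comp {X Y Z : C} (R : Crible X Y) (S : Crible Y Z) :
    ((R.close J).comp S).close J = (R.comp S).close J :=
  le_antisymm (close_le J (close_isClosed J _) (close_comp_le J R S))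
    (close_mono J (comp_mono (le_close J R) le_rfl))

theorem comp_close {X Y Z : C} (R : Crible X Y) (S : Crible Y Z) :
    (R.comp (S.close J)).close J = (R.comp S).close J :=
  le_antisymm (close_le J (close_isClosed J _) (comp_close_le J R S))
    (close_mono J (comp_mono le_rfl (le_close J S)))

theorem id_comp {X Y : C} (R : Crible X Y) : (Crible.id X).comp R = R := by
  ext W f g
  constructor
  · rintro ⟨_, rfl, h⟩; exact h
  · intro h; exact ⟨f, rfl, h⟩

theorem comp_id {X Y : C} (R : Crible X Y) : R.comp (Crible.id Y) = R := by
  ext W f g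
  constructor
  · rintro ⟨_, h, rfl⟩; exact h
  · intro h; exact ⟨g, h, rfl⟩

theorem comp_assoc {X Y Z W : C} (R : Crible X Y) (S : Crible Y Z) (T : Crible Z W) :
    (R.comp S).comp T = R.comp (S.comp T) := by
  ext V f k
  constructor
  · rintro ⟨h, ⟨g, hR, hS⟩, hT⟩; exact ⟨g, hR, h, hS, hT⟩
  · rintro ⟨g, hR, h, hS, hT⟩; exact ⟨h, ⟨g, hR, hS⟩, hT⟩

end Crible

/-- A closed crible from `X` to `Y`. -/
@[ext]
structure ClosedCrible (J : GrothendieckTopology C) (X Y : C) where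
  crible : Crible X Y
  isClosed : crible.IsClosed J

namespace ClosedCrible

variable {J : GrothendieckTopology C}

/-- Closed cribles are ordered by inclusion. -/
instance (X Y : C) : PartialOrder (ClosedCrible J X Y) :=
  PartialOrder.lift ClosedCrible.crible fun _ _ h => ClosedCrible.ext h

/-- The supremum of a set of closed cribles is the closure of its union. -/
instance (X Y : C) : SupSet (ClosedCrible J X Y) where
  sSup 𝓡 := ⟨(Crible.sUnion (ClosedCrible.crible '' 𝓡)).close J, Crible.close_isClosed J _⟩

theorem isLUB_sSup {X Y : C} (𝓡 : Set (ClosedCrible J X Y)) : IsLUB 𝓡 (sSup 𝓡) := by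
  constructor
  · intro R hR
    exact le_trans (b := Crible.sUnion (ClosedCrible.crible '' 𝓡))
      (fun W f g h => ⟨R.crible, ⟨R, hR, rfl⟩, h⟩) (Crible.le_close J _)
  · intro S hS
    refine Crible.close_le J S.isClosed ?_
    rintro W f g ⟨_, ⟨R, hR, rfl⟩, h⟩
    exact hS hR f g h

instance (X Y : C) : CompleteLattice (ClosedCrible J X Y) :=
  completeLatticeOfSup _ isLUB_sSup

end ClosedCrible

/-- The objects of the quantaloid of closed cribles in a site `(C, J)`: the objects of `C`. -/
structure CribleQuantaloid (J : GrothendieckTopology C) where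
  obj : C

/-- The quantaloid of closed cribles in a site `(C, J)`. The identities and the composites are the
closures of the identities and of the composites of cribles. -/
instance (J : GrothendieckTopology C) : Quantaloid (CribleQuantaloid J) where
  Hom X Y := ClosedCrible J X.obj Y.obj
  id X := ⟨(Crible.id X.obj).close J, Crible.close_isClosed J _⟩
  comp R S := ⟨(R.crible.comp S.crible).close J, Crible.close_isClosed J _⟩
  id_comp R := ClosedCrible.ext <| by
    change (((Crible.id _).close J).comp R.crible).close J = R.crible
    rw [Crible.close_comp, Crible.id_comp, Crible.close_eq J R.isClosed]
  comp_id R := ClosedCrible.ext <| by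
    change (R.crible.comp ((Crible.id _).close J)).close J = R.crible
    rw [Crible.comp_close, Crible.comp_id, Crible.close_eq J R.isClosed]
  assoc R S T := ClosedCrible.ext <| by
    change (((R.crible.comp S.crible).close J).comp T.crible).close J =
      (R.crible.comp ((S.crible.comp T.crible).close J)).close J
    rw [Crible.close_comp, Crible.comp_close, Crible.comp_assoc]
  homLattice X Y := inferInstanceAs (CompleteLattice (ClosedCrible J X.obj Y.obj))
  comp_sSup R 𝓢 := ClosedCrible.ext <| by
    change (R.crible.comp ((Crible.sUnion (ClosedCrible.crible '' 𝓢)).close J)).close J =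
      (Crible.sUnion (ClosedCrible.crible '' _)).close J
    rw [Crible.comp_close]
    apply le_antisymm
    · refine Crible.close_mono J ?_
      rintro W f h ⟨g, hR, _, ⟨S, hS, rfl⟩, hg⟩
      exact ⟨_, ⟨_, ⟨S, hS, rfl⟩, rfl⟩, Crible.le_close J _ _ _ ⟨g, hR, hg⟩⟩
    · refine Crible.close_le J (Crible.close_isClosed J _) ?_
      rintro W f h ⟨_, ⟨_, ⟨S, hS, rfl⟩, rfl⟩, hfh⟩
      refine Crible.close_mono J (Crible.comp_mono le_rfl ?_) _ _ hfh
      exact fun W f g hfg => ⟨S.crible, ⟨S, hS, rfl⟩, hfg⟩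
  sSup_comp 𝓡 S := ClosedCrible.ext <| by
    change (((Crible.sUnion (ClosedCrible.crible '' 𝓡)).close J).comp S.crible).close J =
      (Crible.sUnion (ClosedCrible.crible '' _)).close J
    rw [Crible.close_comp]
    apply le_antisymm
    · refine Crible.close_mono J ?_
      rintro W f h ⟨g, ⟨_, ⟨R, hR, rfl⟩, hg⟩, hS⟩
      exact ⟨_, ⟨_, ⟨R, hR, rfl⟩, rfl⟩, Crible.le_close J _ _ _ ⟨g, hg, hS⟩⟩
    · refine Crible.close_le J (Crible.close_isClosed J _) ?_
      rintro W f h ⟨_, ⟨_, ⟨R, hR, rfl⟩, rfl⟩, hfh⟩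
      refine Crible.close_mono J (Crible.comp_mono ?_ le_rfl) _ _ hfh
      exact fun W f g hfg => ⟨R.crible, ⟨R, hR, rfl⟩, hfg⟩

end Cribles

/-- `Q` is a small quantaloid of closed cribles: it is equivalent, as a quantaloid, to the
quantaloid of closed cribles in some small site. -/
def IsSmallQuantaloidOfClosedCribles (Q : Type u) [Quantaloid.{u} Q] : Prop :=
  ∃ (C : Type u) (_ : SmallCategory C) (J : GrothendieckTopology C)
    (F : Quantaloid.Homomorphism Q (CribleQuantaloid J)), F.IsEquivalence

/-! ### Splitting a class of idempotents -/

/-- A class of idempotents in a quantaloid. -/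
structure IdempotentClass (Q : Type u) [Quantaloid.{v} Q] where
  carrier : ∀ A : Q, Set (A ⟶ A)
  idem : ∀ {A : Q} (e : A ⟶ A), e ∈ carrier A → e ≫ e = e

namespace IdempotentClass

variable {Q : Type u} [Quantaloid.{v} Q]

/-- All idempotents in the class are symmetric. -/
def IsSymmetric (E : IdempotentClass Q) (ι : Involution Q) : Prop :=
  ∀ (A : Q), ∀ e ∈ E.carrier A, ι.inv e = e

/-- All identities belong to the class. -/
def ContainsIdentities (E : IdempotentClass Q) : Prop :=
  ∀ A : Q, 𝟙 A ∈ E.carrier A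

/-- The objects of the quantaloid which is obtained from `Q` by splitting the idempotents in the
class: the elements of the class. -/
structure Split (E : IdempotentClass Q) where
  obj : Q
  e : obj ⟶ obj
  mem : e ∈ E.carrier obj

variable {E : IdempotentClass Q}

/-- The morphisms from `e` to `f` are the morphisms `x` of `Q` with `f ∘ x = x = x ∘ e`. -/
@[ext]
structure SplitHom (X Y : E.Split) where
  val : X.obj ⟶ Y.obj
  comp_e : val ≫ Y.e = val
  e_comp : X.e ≫ val = val

instance (X Y : E.Split) : PartialOrder (SplitHom X Y) :=
  PartialOrder.lift SplitHom.val fun _ _ h => SplitHom.ext h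

instance (X Y : E.Split) : SupSet (SplitHom X Y) where
  sSup S :=
    { val := sSup (SplitHom.val '' S)
      comp_e := by
        rw [Quantaloid.sSup_comp, Set.image_image]
        simp only [SplitHom.comp_e]
      e_comp := by
        rw [Quantaloid.comp_sSup, Set.image_image]
        simp only [SplitHom.e_comp] }

theorem SplitHom.val_sSup {X Y : E.Split} (S : Set (SplitHom X Y)) :
    (sSup S).val = sSup (SplitHom.val '' S) := rfl

theorem SplitHom.isLUB_sSup {X Y : E.Split} (S : Set (SplitHom X Y)) : IsLUB S (sSup S) := by
  constructor
  · intro x hx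
    exact le_sSup (α := X.obj ⟶ Y.obj) ⟨x, hx, rfl⟩
  · intro y hy
    refine sSup_le (α := X.obj ⟶ Y.obj) ?_
    rintro _ ⟨x, hx, rfl⟩
    exact hy hx

instance (X Y : E.Split) : CompleteLattice (SplitHom X Y) :=
  completeLatticeOfSup _ SplitHom.isLUB_sSup

/-- The quantaloid which is obtained from `Q` by splitting the idempotents in the class: the
composition and the suprema are those of `Q`, the identity on `e` is `e`. -/
instance : Quantaloid.{v} E.Split where
  Hom X Y := SplitHom X Y
  id X := ⟨X.e, E.idem _ X.mem, E.idem _ X.mem⟩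
  comp x y := ⟨x.val ≫ y.val, by rw [Category.assoc, y.comp_e], by rw [← Category.assoc, x.e_comp]⟩
  id_comp x := SplitHom.ext x.e_comp
  comp_id x := SplitHom.ext x.comp_e
  assoc x y z := SplitHom.ext (Category.assoc _ _ _)
  homLattice X Y := inferInstanceAs (CompleteLattice (SplitHom X Y))
  comp_sSup x S := SplitHom.ext <| by
    change x.val ≫ sSup (SplitHom.val '' S) = sSup (SplitHom.val '' _)
    rw [Quantaloid.comp_sSup, Set.image_image, Set.image_image]
  sSup_comp S x := SplitHom.ext <| by
    change sSup (SplitHom.val '' S) ≫ x.val = sSup (SplitHom.val '' _)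
    rw [Quantaloid.sSup_comp, Set.image_image, Set.image_image]

/-- The involution on the splitting of a class of symmetric idempotents: it is computed as
in `Q`. -/
def splitInvolution {ι : Involution Q} (hE : E.IsSymmetric ι) : Involution E.Split where
  inv {X Y} x := ⟨ι.inv x.val,
    by
      have h := ι.inv_comp X.e x.val
      rw [x.e_comp, hE _ _ X.mem] at h
      exact h.symm,
    by
      have h := ι.inv_comp x.val Y.e
      rw [x.comp_e, hE _ _ Y.mem] at h
      exact h.symm⟩
  inv_id X := SplitHom.ext (hE _ _ X.mem)
  inv_comp x y := SplitHom.ext (ι.inv_comp _ _)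
  inv_sSup S := SplitHom.ext <| by
    change ι.inv (sSup (SplitHom.val '' S)) = sSup (SplitHom.val '' _)
    rw [ι.inv_sSup, Set.image_image, Set.image_image]
    rfl
  inv_inv x := SplitHom.ext (ι.inv_inv _)

/-- The inclusion of `Q` in the splitting of a class of symmetric idempotents which contains all
identities: it sends `x : A ⟶ B` to `x : 1_A ⟶ 1_B`. -/
def inclusion {ι : Involution Q} (hE : E.IsSymmetric ι) (hid : E.ContainsIdentities) :
    InvHomomorphism ι (splitInvolution hE) where
  obj A := ⟨A, 𝟙 A, hid A⟩
  map x := ⟨x, Category.comp_id x, Category.id_comp x⟩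
  map_id _ := rfl
  map_comp _ _ := rfl
  map_sSup S := SplitHom.ext <| by
    refine Eq.trans ?_ (SplitHom.val_sSup _).symm
    rw [Set.image_image]
    exact congrArg sSup (Set.image_id S).symm
  map_inv _ := rfl

end IdempotentClass

/-! ### Enriched categories and distributors -/

section Enriched

variable {Q : Type u} [Quantaloid.{u} Q]

/-- A category enriched in the small quantaloid `Q`. The morphism `hom x y : ty x ⟶ ty y` is the
hom-arrow usually written `A(y, x)`. -/
structure QCat (Q : Type u) [Quantaloid.{u} Q] where
  ob : Type u
  ty : ob → Q
  hom : ∀ x y : ob, ty x ⟶ ty y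
  id_le : ∀ x : ob, 𝟙 (ty x) ≤ hom x x
  comp_le : ∀ x y z : ob, hom x y ≫ hom y z ≤ hom x z

/-- A distributor `Φ` from `A` to `B`. The morphism `app x y : ty x ⟶ ty y` is the element usually
written `Φ(y, x)`. -/
@[ext]
structure Distributor (A B : QCat Q) where
  app : ∀ (x : A.ob) (y : B.ob), A.ty x ⟶ B.ty y
  app_hom_le : ∀ (x : A.ob) (y y' : B.ob), app x y ≫ B.hom y y' ≤ app x y'
  hom_app_le : ∀ (x' x : A.ob) (y : B.ob), A.hom x' x ≫ app x y ≤ app x' y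

namespace Distributor

/-- The identity distributor on `A` consists of the hom-arrows of `A`. -/
def id (A : QCat Q) : Distributor A A where
  app := A.hom
  app_hom_le := A.comp_le
  hom_app_le := A.comp_le

def comp {A B C : QCat Q} (Φ : Distributor A B) (Ψ : Distributor B C) : Distributor A C where
  app x z := ⨆ y, Φ.app x y ≫ Ψ.app y z
  app_hom_le x z z' := by
    rw [Quantaloid.iSup_comp]
    refine iSup_mono fun y => ?_
    rw [Category.assoc]
    exact Quantaloid.comp_mono le_rfl (Ψ.app_hom_le _ _ _)
  hom_app_le x' x z := by
    rw [Quantaloid.comp_iSup]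
    refine iSup_mono fun y => ?_
    rw [← Category.assoc]
    exact Quantaloid.comp_mono (Φ.hom_app_le _ _ _) le_rfl

theorem id_comp {A B : QCat Q} (Φ : Distributor A B) : (id A).comp Φ = Φ := by
  ext x y
  apply le_antisymm
  · exact iSup_le fun x' => Φ.hom_app_le _ _ _
  · refine le_trans ?_ (le_iSup (fun x' => A.hom x x' ≫ Φ.app x' y) x)
    simpa using Quantaloid.comp_mono (A.id_le x) (le_refl (Φ.app x y))

theorem comp_id {A B : QCat Q} (Φ : Distributor A B) : Φ.comp (id B) = Φ := by
  ext x y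
  apply le_antisymm
  · exact iSup_le fun y' => Φ.app_hom_le _ _ _
  · refine le_trans ?_ (le_iSup (fun y' => Φ.app x y' ≫ B.hom y' y) y)
    simpa using Quantaloid.comp_mono (le_refl (Φ.app x y)) (B.id_le y)

theorem comp_assoc {A B C D : QCat Q} (Φ : Distributor A B) (Ψ : Distributor B C)
    (Θ : Distributor C D) : (Φ.comp Ψ).comp Θ = Φ.comp (Ψ.comp Θ) := by
  ext x w
  change (⨆ z, (⨆ y, Φ.app x y ≫ Ψ.app y z) ≫ Θ.app z w) =
    ⨆ y, Φ.app x y ≫ ⨆ z, Ψ.app y z ≫ Θ.app z w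
  simp only [Quantaloid.iSup_comp, Quantaloid.comp_iSup, Category.assoc]
  exact iSup_comm

/-- Parallel distributors are compared elementwise. -/
instance (A B : QCat Q) : PartialOrder (Distributor A B) :=
  PartialOrder.lift Distributor.app fun _ _ h => Distributor.ext h

theorem le_def {A B : QCat Q} {Φ Ψ : Distributor A B} :
    Φ ≤ Ψ ↔ ∀ x y, Φ.app x y ≤ Ψ.app x y := Iff.rfl

instance (A B : QCat Q) : SupSet (Distributor A B) where
  sSup S :=
    { app := fun x y => ⨆ Φ ∈ S, Distributor.app Φ x y
      app_hom_le := fun x y y' => by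
        simp only [Quantaloid.iSup_comp]
        exact iSup₂_mono fun Φ _ => Φ.app_hom_le _ _ _
      hom_app_le := fun x' x y => by
        simp only [Quantaloid.comp_iSup]
        exact iSup₂_mono fun Φ _ => Φ.hom_app_le _ _ _ }

theorem sSup_app {A B : QCat Q} (S : Set (Distributor A B)) (x : A.ob) (y : B.ob) :
    (sSup S).app x y = ⨆ Φ ∈ S, Distributor.app Φ x y := rfl

theorem isLUB_sSup {A B : QCat Q} (S : Set (Distributor A B)) : IsLUB S (sSup S) := by
  constructor
  · intro Φ hΦ x y
    exact le_iSup₂ (f := fun (Φ : Distributor A B) (_ : Φ ∈ S) => Φ.app x y) Φ hΦ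
  · intro Ψ hΨ x y
    exact iSup₂_le fun Φ hΦ => hΨ hΦ x y

instance (A B : QCat Q) : CompleteLattice (Distributor A B) :=
  completeLatticeOfSup _ isLUB_sSup

theorem comp_sSup {A B C : QCat Q} (Φ : Distributor A B) (S : Set (Distributor B C)) :
    Φ.comp (sSup S) = sSup ((fun Ψ => Φ.comp Ψ) '' S) := by
  ext x z
  change (⨆ y, Φ.app x y ≫ ⨆ Ψ ∈ S, Distributor.app Ψ y z) =
    ⨆ Θ ∈ (fun Ψ => Φ.comp Ψ) '' S, Distributor.app Θ x z
  rw [iSup_image]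
  simp only [Quantaloid.comp_iSup]
  rw [iSup_comm]
  exact iSup_congr fun Ψ => iSup_comm

theorem sSup_comp {A B C : QCat Q} (S : Set (Distributor A B)) (Ψ : Distributor B C) :
    (sSup S).comp Ψ = sSup ((fun Φ => Φ.comp Ψ) '' S) := by
  ext x z
  change (⨆ y, (⨆ Φ ∈ S, Distributor.app Φ x y) ≫ Ψ.app y z) =
    ⨆ Θ ∈ (fun Φ => Φ.comp Ψ) '' S, Distributor.app Θ x z
  rw [iSup_image]
  simp only [Quantaloid.iSup_comp]
  rw [iSup_comm]
  exact iSup_congr fun Φ => iSup_comm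

end Distributor

/-- The objects of `SymDist(Q)`: the symmetric `Q`-categories. -/
structure SymDist (ι : Involution Q) extends QCat Q where
  symm : ∀ x y : ob, ι.inv (hom x y) = hom y x

/-- The quantaloid of symmetric `Q`-categories and distributors. -/
instance (ι : Involution Q) : Quantaloid.{u} (SymDist ι) where
  Hom A B := Distributor A.toQCat B.toQCat
  id A := Distributor.id A.toQCat
  comp Φ Ψ := Φ.comp Ψ
  id_comp := Distributor.id_comp
  comp_id := Distributor.comp_id
  assoc := Distributor.comp_assoc
  homLattice A B := inferInstanceAs (CompleteLattice (Distributor A.toQCat B.toQCat))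
  comp_sSup := Distributor.comp_sSup
  sSup_comp := Distributor.sSup_comp

namespace SymDist

/-- The involute of a distributor between symmetric `Q`-categories. -/
def involute {ι : Involution Q} {A B : SymDist ι} (Φ : Distributor A.toQCat B.toQCat) :
    Distributor B.toQCat A.toQCat where
  app y x := ι.inv (Φ.app x y)
  app_hom_le y x x' := by
    rw [← A.symm, ← ι.inv_comp]
    exact ι.inv_mono (Φ.hom_app_le _ _ _)
  hom_app_le y' y x := by
    rw [← B.symm, ← ι.inv_comp]
    exact ι.inv_mono (Φ.app_hom_le _ _ _)

/-- The involution on `SymDist(Q)`. -/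
def involution (ι : Involution Q) : Involution (SymDist ι) where
  inv Φ := involute Φ
  inv_id A := Distributor.ext <| by
    funext x y
    exact A.symm y x
  inv_comp Φ Ψ := Distributor.ext <| by
    funext z x
    change ι.inv (⨆ y, Φ.app x y ≫ Ψ.app y z) = ⨆ y, ι.inv (Ψ.app y z) ≫ ι.inv (Φ.app x y)
    rw [ι.inv_iSup]
    simp only [ι.inv_comp]
  inv_sSup {A B} S := Distributor.ext <| by
    funext y x
    change ι.inv (⨆ Φ ∈ S, Distributor.app Φ x y) = ⨆ Θ ∈ involute '' S, Distributor.app Θ y x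
    rw [iSup_image]
    simp only [ι.inv_iSup]
    rfl
  inv_inv Φ := Distributor.ext <| by
    funext x y
    exact ι.inv_inv _

/-- The change of base homomorphism `SymDist(Q) ⟶ SymDist(R)` which is induced by a homomorphism
`Q ⟶ R` of involutive quantaloids: it applies this homomorphism to the types, to the hom-arrows
and to the elements of distributors. -/
def changeOfBase {R : Type u} [Quantaloid.{u} R] {ι : Involution Q} {κ : Involution R}
    (F : InvHomomorphism ι κ) : InvHomomorphism (involution ι) (involution κ) where
  obj A :=
    { ob := A.ob
      ty := fun x => F.obj (A.ty x)
      hom := fun x y => F.map (A.hom x y)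
      id_le := fun x => by
        rw [← F.map_id]
        exact F.map_mono (A.id_le x)
      comp_le := fun x y z => by
        rw [← F.map_comp]
        exact F.map_mono (A.comp_le x y z)
      symm := fun x y => by
        rw [← F.map_inv, A.symm] }
  map {A B} Φ :=
    { app := fun x y => F.map (Distributor.app Φ x y)
      app_hom_le := fun x y y' => by
        rw [← F.map_comp]
        exact F.map_mono (Distributor.app_hom_le Φ x y y')
      hom_app_le := fun x' x y => by
        rw [← F.map_comp]
        exact F.map_mono (Distributor.hom_app_le Φ x' x y) }
  map_id _ := rfl
  map_comp {A B C} Φ Ψ := Distributor.ext <| by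
    funext x z
    change F.map (⨆ y, Distributor.app Φ x y ≫ Distributor.app Ψ y z) =
      ⨆ y, F.map (Distributor.app Φ x y) ≫ F.map (Distributor.app Ψ y z)
    rw [F.map_iSup]
    simp only [F.map_comp]
  map_sSup {A B} S := Distributor.ext <| by
    funext x y
    refine Eq.trans ?_ (Distributor.sSup_app _ _ _).symm
    refine (congrArg F.map (Distributor.sSup_app S x y)).trans ?_
    rw [iSup_image]
    simp only [F.map_iSup]
    rfl
  map_inv Φ := Distributor.ext <| by
    funext y x
    exact F.map_inv _

end SymDist

end Enriched

/-! Write f° for the involute, compose diagrammatically, and call f a map when f° is its right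
adjoint. The proof isolates a property of an involution, `IsTabular`, which can be tested without a
site: spans of maps detect the order, and an identity below a supremum of composites is so locally,
along maps through the middle objects. Reversal of spans in closed cribles is tabular, the graphs of
the morphisms of the site being enough maps (`CribleQuantaloid.involution_isTabular`).

Tabularity has two consequences. First, every left adjoint is a map (`IsTabular.right_adjoint_eq`),
so the formula with adjoints computes the involution (`IsTabular.isCanonical`). Second, the
quantaloid is one of closed cribles: its maps form a small category, on which the jointly covering
sieves are a topology, and q ↦ {(f, g) | f° ≫ g ≤ q} is an order isomorphism onto closed cribles
compatible with composition. The involution of `Q` itself is pulled back along the given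
equivalence.

The other notion is density: F is dense if 1_Z is the supremum of all k° ≫ k, for maps k into Z from
objects in the image of F. Along a dense fully faithful F, every morphism is glued from its corners
k ≫ q ≫ l°, which come from the domain; hence tabularity passes to the codomain. Also, a symmetric
category over the codomain is isomorphic to the one indexed by all maps into its types, which lives
over the domain; hence change of base is an equivalence. Both parts of the theorem therefore reduce
to the density of `Q` in its splitting (`inclusion_isDense`): a span (f, g) of maps below a
symmetric idempotent e lies below k° ≫ k, where k = f ≫ e is a map from an identity to e. -/

namespace Quantaloid

attribute [gcongr] comp_mono

/-! ### Adjunctions in a quantaloid -/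

section Adjoints

variable {Q : Type u} [Quantaloid.{v} Q]

theorem IsAdj.comp {X Y Z : Q} {f : X ⟶ Y} {f' : Y ⟶ X} {g : Y ⟶ Z} {g' : Z ⟶ Y}
    (hf : IsAdj f f') (hg : IsAdj g g') : IsAdj (f ≫ g) (g' ≫ f') := by
  constructor
  · calc 𝟙 X ≤ f ≫ 𝟙 Y ≫ f' := by simpa using hf.1
      _ ≤ f ≫ (g ≫ g') ≫ f' := by gcongr; exact hg.1
      _ = (f ≫ g) ≫ g' ≫ f' := by simp
  · calc (g' ≫ f') ≫ f ≫ g = g' ≫ (f' ≫ f) ≫ g := by simp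
      _ ≤ g' ≫ 𝟙 Y ≫ g := by gcongr; exact hf.2
      _ ≤ 𝟙 Z := by simpa using hg.2

/-- Together with `comp_right_le_iff`, this moves left adjoints across inequalities; nearly every
later calculation with spans is a chain of such transpositions. -/
theorem IsAdj.comp_le_iff {X Y Z : Q} {f : X ⟶ Y} {f' : Y ⟶ X} (hf : IsAdj f f')
    {g : X ⟶ Z} {q : Y ⟶ Z} : f' ≫ g ≤ q ↔ g ≤ f ≫ q := by
  constructor
  · intro h
    calc g = 𝟙 X ≫ g := by simp
      _ ≤ (f ≫ f') ≫ g := by gcongr; exact hf.1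
      _ = f ≫ f' ≫ g := by simp
      _ ≤ f ≫ q := by gcongr
  · intro h
    calc f' ≫ g ≤ f' ≫ f ≫ q := by gcongr
      _ = (f' ≫ f) ≫ q := by simp
      _ ≤ 𝟙 Y ≫ q := by gcongr; exact hf.2
      _ = q := by simp

theorem IsAdj.comp_right_le_iff {X Y Z : Q} {f : X ⟶ Y} {f' : Y ⟶ X} (hf : IsAdj f f')
    {g : Z ⟶ X} {q : Z ⟶ Y} : g ≫ f ≤ q ↔ g ≤ q ≫ f' := by
  constructor
  · intro h
    calc g = g ≫ 𝟙 X := by simp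
      _ ≤ g ≫ f ≫ f' := by gcongr; exact hf.1
      _ = (g ≫ f) ≫ f' := by simp
      _ ≤ q ≫ f' := by gcongr
  · intro h
    calc g ≫ f ≤ (q ≫ f') ≫ f := by gcongr
      _ = q ≫ f' ≫ f := by simp
      _ ≤ q ≫ 𝟙 Y := by gcongr; exact hf.2
      _ = q := by simp

theorem IsAdj.right_le_right {X Y : Q} {f g : X ⟶ Y} {f' g' : Y ⟶ X} (hf : IsAdj f f')
    (hg : IsAdj g g') (h : f ≤ g) : g' ≤ f' := by
  have := hf.comp_right_le_iff.1 (le_trans (by gcongr) hg.2 : g' ≫ f ≤ 𝟙 Y)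
  simpa using this

theorem IsAdj.left_le_left {X Y : Q} {f g : X ⟶ Y} {f' g' : Y ⟶ X} (hf : IsAdj f f')
    (hg : IsAdj g g') (h : g' ≤ f') : f ≤ g := by
  have := hg.comp_le_iff.1 (le_trans (by gcongr) hf.2 : g' ≫ f ≤ 𝟙 Y)
  simpa using this

/-- Morphisms out of `X` are equal when they agree on a family which covers `X`. -/
theorem hom_ext_of_cover {W X : Q} {S : Set (X ⟶ X)} (hS : 𝟙 X ≤ sSup S)
    (hS' : sSup S ≤ 𝟙 X) {p q : W ⟶ X} (h : ∀ x ∈ S, p ≫ x = q ≫ x) : p = q := by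
  rw [← Category.comp_id p, ← Category.comp_id q, le_antisymm hS hS', Quantaloid.comp_sSup,
    Quantaloid.comp_sSup, Set.image_congr h]

theorem isAdj_iso {X Y : Q} (i : X ≅ Y) : IsAdj i.hom i.inv :=
  ⟨by simp, by simp⟩

end Adjoints

theorem Homomorphism.map_isAdj {Q : Type u} {R : Type u'} [Quantaloid.{v} Q] [Quantaloid.{v'} R]
    (F : Homomorphism Q R) {X Y : Q} {f : X ⟶ Y} {f' : Y ⟶ X} (h : IsAdj f f') :
    IsAdj (F.map f) (F.map f') := by
  constructor
  · rw [← F.map_comp, ← F.map_id]; exact F.map_mono h.1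
  · rw [← F.map_comp, ← F.map_id]; exact F.map_mono h.2

/-- Binary suprema encode the order, so faithfulness alone makes a homomorphism reflect it. -/
theorem Homomorphism.map_le_map_iff {Q : Type u} {R : Type u'} [Quantaloid.{v} Q]
    [Quantaloid.{v'} R] (F : Homomorphism Q R) [F.Faithful] {X Y : Q} {f g : X ⟶ Y} :
    F.map f ≤ F.map g ↔ f ≤ g := by
  refine ⟨fun h => ?_, F.map_mono⟩
  have h' := F.map_sSup {f, g}
  rw [Set.image_pair, sSup_pair, sSup_pair, sup_eq_right.2 h] at h'
  exact sup_eq_right.1 (F.map_injective h')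

namespace Involution

/-! ### Maps and tabular involutions -/

section Maps

variable {Q : Type u} [Quantaloid.{v} Q] (ι : Involution Q)

theorem inv_le_inv_iff {X Y : Q} {f g : X ⟶ Y} : ι.inv f ≤ ι.inv g ↔ f ≤ g :=
  ⟨fun h => by simpa only [ι.inv_inv] using ι.inv_mono h, ι.inv_mono⟩

/-- A map: a left adjoint whose involute is right adjoint to it. -/
def IsMap {X Y : Q} (f : X ⟶ Y) : Prop := IsAdj f (ι.inv f)

variable {ι}

theorem isMap_id (X : Q) : ι.IsMap (𝟙 X) := by
  constructor <;> simp [ι.inv_id]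

theorem IsMap.comp {X Y Z : Q} {f : X ⟶ Y} {g : Y ⟶ Z} (hf : ι.IsMap f) (hg : ι.IsMap g) :
    ι.IsMap (f ≫ g) := by
  unfold IsMap
  rw [ι.inv_comp]
  exact IsAdj.comp hf hg

/-- Passing to right adjoints reverses the order while the involution preserves it; on maps the two
operations agree, so maps are ordered discretely. -/
theorem IsMap.eq_of_le {X Y : Q} {f g : X ⟶ Y} (hf : ι.IsMap f) (hg : ι.IsMap g) (h : f ≤ g) :
    f = g :=
  le_antisymm h (ι.inv_le_inv_iff.1 (IsAdj.right_le_right hf hg h))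

/-- A span of maps lies in the tabulated morphism of a cospan of maps exactly when the resulting
square commutes. -/
theorem IsMap.span_le_cospan_iff {X Y Z W : Q} {f : Z ⟶ X} {g : Z ⟶ Y} {h : X ⟶ W} {k : Y ⟶ W}
    (hf : ι.IsMap f) (hg : ι.IsMap g) (hh : ι.IsMap h) (hk : ι.IsMap k) :
    ι.inv f ≫ g ≤ h ≫ ι.inv k ↔ f ≫ h = g ≫ k := by
  rw [IsAdj.comp_le_iff hf, ← Category.assoc, ← IsAdj.comp_right_le_iff hk]
  exact ⟨fun h' => ((hg.comp hk).eq_of_le (hf.comp hh) h').symm, fun h' => h'.ge⟩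

end Maps

/-- Every morphism is covered by spans of maps, and whenever an identity lies below a supremum of
composites, it does so locally: over the members of a covering family of maps. -/
structure IsTabular {Q : Type u} [Quantaloid.{u} Q] (ι : Involution Q) : Prop where
  le_of_span_le : ∀ {X Y : Q} (q r : X ⟶ Y),
    (∀ (Z : Q) (f : Z ⟶ X) (g : Z ⟶ Y), ι.IsMap f → ι.IsMap g → ι.inv f ≫ g ≤ q →
      ι.inv f ≫ g ≤ r) → q ≤ r
  id_le_of_local : ∀ {V : Q} {I : Type u} (Y : I → Q) (p : ∀ i, V ⟶ Y i) (q : ∀ i, Y i ⟶ V),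
    𝟙 V ≤ ⨆ i, p i ≫ q i → ∀ r : V ⟶ V,
    (∀ (i : I) (U : Q) (k : U ⟶ V) (m : U ⟶ Y i), ι.IsMap k → ι.IsMap m →
      ι.inv k ≫ m ≤ p i → ι.inv m ≫ k ≤ q i → ι.inv k ≫ k ≤ r) → 𝟙 V ≤ r

/-! ### Tabular involutions are canonical -/

namespace IsTabular

variable {Q : Type u} [Quantaloid.{u} Q] {ι : Involution Q}

/-- The unit 1 ≤ f ≫ f' holds locally through maps m. On such a piece k, the map m equals k ≫ f, so
the right adjoint of k ≫ f is its involute; these pieces cover `X`. -/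
theorem right_adjoint_eq (h : ι.IsTabular) {X Y : Q} {f : X ⟶ Y} {f' : Y ⟶ X}
    (hf : IsAdj f f') : f' = ι.inv f := by
  have key : 𝟙 X ≤ sSup {x | ∃ (U : Q) (k : U ⟶ X), f' ≫ ι.inv k = ι.inv f ≫ ι.inv k ∧
      ι.IsMap k ∧ x = ι.inv k ≫ k} := by
    refine h.id_le_of_local (I := PUnit) (fun _ => Y) (fun _ => f) (fun _ => f')
      (by simpa using hf.1) _ fun _ U k m hk hm h1 h2 => le_sSup ⟨U, k, ?_, hk, rfl⟩
    have h3 : m ≤ k ≫ f := (IsAdj.comp_le_iff hk).1 h1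
    have h4 : ι.inv m ≤ f' ≫ ι.inv k := (IsAdj.comp_right_le_iff hk).1 h2
    have h5 := IsAdj.comp hk hf
    -- From m ≤ k ≫ f the right adjoints compare the other way, which turns the inequality `h4` into
    -- an equality; equal right adjoints then force equal left adjoints.
    have h6 : f' ≫ ι.inv k = ι.inv m := le_antisymm (IsAdj.right_le_right hm h5 h3) h4
    have h7 : k ≫ f = m := le_antisymm (IsAdj.left_le_left h5 hm h6.ge) h3
    rw [h6, ← h7, ι.inv_comp]
  refine hom_ext_of_cover key (sSup_le ?_) ?_
  · rintro _ ⟨U, k, -, hk, rfl⟩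
    exact hk.2
  rintro _ ⟨U, k, hk, -, rfl⟩
  rw [← Category.assoc, hk, Category.assoc]

/-- Spans of maps detect the order, which bounds the involute by the supremum; conversely all left
adjoints in the formula are maps, so each of its terms is the involute of something below q. -/
theorem isCanonical (h : ι.IsTabular) : ι.IsCanonical := by
  intro X Y q
  apply le_antisymm
  · refine h.le_of_span_le _ _ fun Z f g hf hg hfg => le_sSup ⟨Z, f, ι.inv f, g, ι.inv g, hf, hg,
      ?_, rfl⟩
    have := ι.inv_mono hfg
    simpa only [ι.inv_comp, ι.inv_inv] using this
  · refine sSup_le ?_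
    rintro _ ⟨Z, f, f', g, g', hf, hg, hfg, rfl⟩
    rw [h.right_adjoint_eq hf]
    rw [h.right_adjoint_eq hg] at hfg
    have := ι.inv_mono hfg
    simpa only [ι.inv_comp, ι.inv_inv] using this

end IsTabular
end Involution

/-! ### Dense homomorphisms -/

section Density

variable {Q R : Type u} [Quantaloid.{u} Q] [Quantaloid.{u} R] {ι : Involution Q}
  {κ : Involution R}

/-- The maps into `Z` from objects in the image of `F`. -/
structure InvHomomorphism.MapInto (F : InvHomomorphism ι κ) (Z : R) where
  dom : Q
  map : F.obj dom ⟶ Z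
  isMap : κ.IsMap map

/-- Every object of the codomain is covered by maps from objects in the image. -/
def InvHomomorphism.IsDense (F : InvHomomorphism ι κ) : Prop :=
  ∀ Z : R, 𝟙 Z ≤ ⨆ k : F.MapInto Z, κ.inv k.map ≫ k.map

namespace InvHomomorphism

variable {F : InvHomomorphism ι κ}

theorem IsDense.iSup_eq (hF : F.IsDense) (Z : R) :
    ⨆ k : F.MapInto Z, κ.inv k.map ≫ k.map = 𝟙 Z :=
  le_antisymm (iSup_le fun k => k.isMap.2) (hF Z)

theorem IsDense.iSup_comp_comp (hF : F.IsDense) {X Y Z : R} (p : X ⟶ Z) (q : Z ⟶ Y) :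
    ⨆ k : F.MapInto Z, (p ≫ κ.inv k.map) ≫ k.map ≫ q = p ≫ q := by
  calc ⨆ k : F.MapInto Z, (p ≫ κ.inv k.map) ≫ k.map ≫ q
      = p ≫ (⨆ k : F.MapInto Z, κ.inv k.map ≫ k.map) ≫ q := by
        simp only [Quantaloid.iSup_comp, Quantaloid.comp_iSup, Category.assoc]
    _ = p ≫ q := by rw [hF.iSup_eq, Category.id_comp]

theorem map_isMap (F : InvHomomorphism ι κ) {X Y : Q} {f : X ⟶ Y} (h : ι.IsMap f) :
    κ.IsMap (F.map f) := by
  have := F.map_isAdj h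
  rwa [F.map_inv] at this

/-- Tabularity passes from `Q` to `R` along a dense fully faithful homomorphism. -/
theorem IsDense.isTabular (hF : F.IsDense) [F.Full] [F.Faithful] (h : ι.IsTabular) :
    κ.IsTabular where
  le_of_span_le {X Y} q r H := by
    -- Inserting the covers of `X` and of `Y` on the two sides glues q from its corners, to which
    -- fullness applies.
    have hq : q = ⨆ k : F.MapInto X, ⨆ l : F.MapInto Y,
        κ.inv k.map ≫ (k.map ≫ q ≫ κ.inv l.map) ≫ l.map := by
      have h1 := fun k : F.MapInto X => hF.iSup_comp_comp (k.map ≫ q) (𝟙 Y)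
      have h2 := hF.iSup_comp_comp (𝟙 X) q
      rw [Category.id_comp] at h2
      refine h2.symm.trans (iSup_congr fun k => ?_)
      rw [Category.id_comp, ← Category.comp_id (k.map ≫ q), ← h1, Quantaloid.comp_iSup]
      simp
    rw [hq]
    refine iSup₂_le fun k l => ?_
    obtain ⟨q', hq'⟩ := F.map_surjective (k.map ≫ q ≫ κ.inv l.map)
    have h3 : q' ≤ F.preimage (k.map ≫ r ≫ κ.inv l.map) := by
      refine h.le_of_span_le _ _ fun Z f g hf hg hfg => ?_
      rw [← F.map_le_map_iff, F.map_preimage, F.map_comp, F.map_inv]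
      have hf' := F.map_isMap hf
      have hg' := F.map_isMap hg
      have h4 := H _ (F.map f ≫ k.map) (F.map g ≫ l.map) (hf'.comp k.isMap) (hg'.comp l.isMap) ?_
      · rw [κ.inv_comp, Category.assoc, IsAdj.comp_le_iff k.isMap, ← Category.assoc,
          IsAdj.comp_right_le_iff l.isMap] at h4
        simpa using h4
      · rw [κ.inv_comp, Category.assoc, IsAdj.comp_le_iff k.isMap, ← Category.assoc,
          IsAdj.comp_right_le_iff l.isMap]
        have h5 := F.map_mono hfg
        rw [hq', F.map_comp, F.map_inv] at h5
        simpa using h5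
    rw [← F.map_le_map_iff, F.map_preimage, hq'] at h3
    rw [IsAdj.comp_le_iff k.isMap, IsAdj.comp_right_le_iff l.isMap]
    simpa using h3
  id_le_of_local {V I} Y p q hpq r H := by
    refine (hF V).trans (iSup_le fun v => ?_)
    obtain ⟨r', hr'⟩ := F.map_surjective (v.map ≫ r ≫ κ.inv v.map)
    suffices 𝟙 v.dom ≤ r' by
      have := F.map_mono this
      rw [F.map_id, hr', ← Category.assoc, ← IsAdj.comp_right_le_iff v.isMap, Category.id_comp,
        ← IsAdj.comp_le_iff v.isMap] at this
      exact this
    -- The middle objects `Y i` need not lie in the image of `F`, so each is replaced by its cover;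
    -- this enlarges the index set.
    refine h.id_le_of_local (I := Σ i, F.MapInto (Y i)) (fun i => i.2.dom)
      (fun i => F.preimage (v.map ≫ p i.1 ≫ κ.inv i.2.map))
      (fun i => F.preimage (i.2.map ≫ q i.1 ≫ κ.inv v.map)) ?_ r' ?_
    · rw [← F.map_le_map_iff, F.map_id, F.map_iSup, iSup_sigma]
      simp only [F.map_comp, F.map_preimage]
      calc 𝟙 _ ≤ v.map ≫ κ.inv v.map := v.isMap.1
        _ = v.map ≫ 𝟙 V ≫ κ.inv v.map := by simp
        _ ≤ v.map ≫ (⨆ i, p i ≫ q i) ≫ κ.inv v.map := by gcongr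
        _ = _ := ?_
      rw [Quantaloid.iSup_comp, Quantaloid.comp_iSup]
      refine iSup_congr fun i => ?_
      simpa using (hF.iSup_comp_comp (v.map ≫ p i) (q i ≫ κ.inv v.map)).symm
    · rintro ⟨i, y⟩ U k m hk hm h1 h2
      rw [← F.map_le_map_iff, hr', F.map_comp, F.map_inv, ← Category.assoc,
        ← IsAdj.comp_right_le_iff v.isMap, ← IsAdj.comp_le_iff v.isMap]
      rw [← F.map_le_map_iff, F.map_preimage, F.map_comp, F.map_inv, ← Category.assoc,
        ← IsAdj.comp_right_le_iff y.isMap, ← IsAdj.comp_le_iff v.isMap] at h1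
      rw [← F.map_le_map_iff, F.map_preimage, F.map_comp, F.map_inv, ← Category.assoc,
        ← IsAdj.comp_right_le_iff v.isMap, ← IsAdj.comp_le_iff y.isMap] at h2
      have := H i _ _ _ ((F.map_isMap hk).comp v.isMap) ((F.map_isMap hm).comp y.isMap)
        (by simpa [κ.inv_comp] using h1) (by simpa [κ.inv_comp] using h2)
      simpa [κ.inv_comp] using this

end InvHomomorphism

end Density

end Quantaloid

/-! ### Equivalences -/

namespace Quantaloid

section PseudoInverse

variable {Q : Type u} {R : Type u'} [Quantaloid.{v} Q] [Quantaloid.{v'} R]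

/-- The pseudo-inverse of a fully faithful homomorphism `F` which is given by choosing, for every
object `Y` of the codomain, an object with an isomorphism from its image to `Y`. -/
noncomputable def Homomorphism.pseudoInverse (F : Homomorphism Q R) [F.Full] [F.Faithful]
    (o : R → Q)
    (i : ∀ Y, F.obj (o Y) ≅ Y) : Homomorphism R Q where
  obj := o
  map {X Y} r := F.preimage ((i X).hom ≫ r ≫ (i Y).inv)
  map_id X := F.map_injective (by simp)
  map_comp f g := F.map_injective (by simp)
  map_sSup S := F.map_injective <| by
    rw [F.map_preimage, F.map_sSup, Set.image_image, Quantaloid.sSup_comp, Quantaloid.comp_sSup,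
      Set.image_image]
    simp only [F.map_preimage]

variable (F : Homomorphism Q R) [F.Full] [F.Faithful] (o : R → Q) (i : ∀ Y, F.obj (o Y) ≅ Y)

theorem Homomorphism.map_pseudoInverse_map {X Y : R} (r : X ⟶ Y) :
    F.map ((F.pseudoInverse o i).map r) = (i X).hom ≫ r ≫ (i Y).inv :=
  F.map_preimage _

noncomputable def Homomorphism.pseudoInverseUnit :
    𝟭 Q ≅ F.toFunctor ⋙ (F.pseudoInverse o i).toFunctor :=
  NatIso.ofComponents (fun X => F.preimageIso (i (F.obj X)).symm) fun {X Y} f =>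
    F.map_injective <| by
      refine (F.map_comp _ _).trans (Eq.trans ?_ (F.map_comp _ _).symm)
      refine Eq.trans ?_ (congrArg₂ (· ≫ ·) (F.map_preimage (i (F.obj X)).inv).symm
        (F.map_pseudoInverse_map o i (F.map f)).symm)
      refine (congrArg (F.map f ≫ ·) (F.map_preimage (i (F.obj Y)).inv)).trans ?_
      exact ((i (F.obj X)).inv_hom_id_assoc _).symm

noncomputable def Homomorphism.pseudoInverseCounit :
    (F.pseudoInverse o i).toFunctor ⋙ F.toFunctor ≅ 𝟭 R :=
  NatIso.ofComponents i fun {X Y} f => by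
    have h : ((i X).hom ≫ f ≫ (i Y).inv) ≫ (i Y).hom = (i X).hom ≫ f := by simp
    exact (congrArg (· ≫ (i Y).hom) (F.map_pseudoInverse_map o i f)).trans h

theorem Homomorphism.isEquivalence_of_iso (F : Homomorphism Q R) [F.Full] [F.Faithful] (o : R → Q)
    (i : ∀ Y, F.obj (o Y) ≅ Y) : F.IsEquivalence :=
  ⟨F.pseudoInverse o i, ⟨F.pseudoInverseUnit o i⟩, ⟨F.pseudoInverseCounit o i⟩⟩

end PseudoInverse

/-- A fully faithful homomorphism of involutive quantaloids is an equivalence if every object of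
the codomain is the image of some object up to an isomorphism whose involute is its inverse. -/
theorem InvHomomorphism.isEquivalence_of_symmetric_iso {Q : Type u} {R : Type u'}
    [Quantaloid.{v} Q] [Quantaloid.{v'} R] {ι : Involution Q} {κ : Involution R}
    (F : InvHomomorphism ι κ) [F.Full] [F.Faithful]
    (H : ∀ Y : R, ∃ (X : Q) (i : F.obj X ≅ Y), κ.inv i.hom = i.inv) : F.IsEquivalence := by
  choose o i hi using H
  have hi' : ∀ Y, κ.inv (i Y).inv = (i Y).hom := fun Y => by rw [← hi, κ.inv_inv]
  have key : ∀ {X Y : R} (r : X ⟶ Y), κ.inv ((i X).hom ≫ r ≫ (i Y).inv) =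
      (i Y).hom ≫ κ.inv r ≫ (i X).inv := fun r => by
    rw [κ.inv_comp, κ.inv_comp, hi, hi', Category.assoc]
  refine ⟨{ F.pseudoInverse o i with
    map_inv := fun {X Y} r => F.map_injective ?_ }, F.pseudoInverseUnit o i,
    F.pseudoInverseCounit o i, fun X => F.map_injective ?_, hi⟩
  · refine (F.map_pseudoInverse_map o i _).trans ?_
    refine Eq.trans ?_ (F.map_inv _).symm
    exact (key r).symm.trans (congrArg κ.inv (F.map_pseudoInverse_map o i r).symm)
  · refine (F.map_inv _).trans ((congrArg κ.inv (F.map_preimage (i (F.obj X)).inv)).trans ?_)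
    exact (hi' _).trans (F.map_preimage (i (F.obj X)).hom).symm

section Restrict

variable {Q : Type u} {R : Type u'} [Quantaloid.{v} Q] [Quantaloid.{v'} R]

/-- The restriction of an involution along a fully faithful homomorphism. -/
noncomputable def Involution.restrict (κ : Involution R) (F : Homomorphism Q R) [F.Full]
    [F.Faithful] :
    Involution Q where
  inv f := F.preimage (κ.inv (F.map f))
  inv_id X := F.map_injective (by simp [κ.inv_id])
  inv_comp f g := F.map_injective (by simp [κ.inv_comp])
  inv_sSup S := F.map_injective <| by
    rw [F.map_preimage, F.map_sSup, κ.inv_sSup, F.map_sSup, Set.image_image, Set.image_image]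
    simp only [F.map_preimage]
  inv_inv f := F.map_injective (by simp [κ.inv_inv])

theorem Involution.map_restrict_inv (κ : Involution R) (F : Homomorphism Q R) [F.Full]
    [F.Faithful] {X Y : Q} (f : X ⟶ Y) : F.map ((κ.restrict F).inv f) = κ.inv (F.map f) :=
  F.map_preimage _

end Restrict

/-- Tabular involutions transfer along equivalences of quantaloids. -/
theorem Involution.IsTabular.exists_of_equivalence {Q R : Type u} [Quantaloid.{u} Q]
    [Quantaloid.{u} R] {κ : Involution R} (h : κ.IsTabular) (F : Homomorphism Q R)
    (hF : F.IsEquivalence) : ∃ ι : Involution Q, ι.IsTabular := by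
  obtain ⟨G, ⟨η⟩, ⟨ε⟩⟩ := hF
  let e := CategoryTheory.Equivalence.mk F.toFunctor G.toFunctor η ε
  have : F.toFunctor.IsEquivalence := e.isEquivalence_functor
  have : G.toFunctor.IsEquivalence := e.isEquivalence_inverse
  -- An isomorphism is left adjoint to its inverse, and right adjoints are involutes for the tabular
  -- `κ`.
  have hF : ∀ {X Y : Q} (i : X ≅ Y), (κ.restrict F).inv i.hom = i.inv := fun i =>
    F.map_injective <| by
      rw [κ.map_restrict_inv, h.right_adjoint_eq (F.map_isAdj (isAdj_iso i))]
  have hε : ∀ Y, κ.inv (ε.hom.app Y) = ε.inv.app Y := fun Y =>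
    (h.right_adjoint_eq (isAdj_iso (ε.app Y))).symm
  have hε' : ∀ Y, κ.inv (ε.inv.app Y) = ε.hom.app Y := fun Y => by rw [← hε, κ.inv_inv]
  have hG : ∀ {X Y : R} (r : X ⟶ Y), F.map (G.map r) = ε.hom.app X ≫ r ≫ ε.inv.app Y := by
    intro X Y r
    have := ε.hom.naturality r
    simp only [Functor.comp_map, Functor.id_map] at this
    rw [← Category.assoc, ← this, Category.assoc]
    simp
  -- Up to `F`, the functor `G` is conjugation by the counit, whose components are symmetric; hence
  -- `G` respects the involutions. Tabularity is then carried along `G`, from `R` to `Q`.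
  let G' : InvHomomorphism κ (κ.restrict F) :=
    { G with
      map_inv := fun {X Y} r => F.map_injective <| by
        rw [κ.map_restrict_inv]
        refine (hG _).trans (Eq.trans ?_ (congrArg κ.inv (hG r).symm))
        rw [κ.inv_comp, κ.inv_comp, hε, hε', Category.assoc] }
  have : G'.Full := inferInstanceAs G.toFunctor.Full
  have : G'.Faithful := inferInstanceAs G.toFunctor.Faithful
  refine ⟨κ.restrict F, InvHomomorphism.IsDense.isTabular (F := G') (fun Z => ?_) h⟩
  let i : G.obj (F.obj Z) ≅ Z := (η.app Z).symm
  have hi : (κ.restrict F).IsMap i.hom := by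
    unfold Involution.IsMap
    rw [hF]
    exact isAdj_iso i
  refine le_trans ?_ (le_iSup (fun k : G'.MapInto Z => (κ.restrict F).inv k.map ≫ k.map)
    ⟨F.obj Z, i.hom, hi⟩)
  rw [hF, i.inv_hom_id]

end Quantaloid

/-! ### Closed cribles: the reversal of spans is a tabular involution -/

section CribleInvolution

variable {C : Type u} [Category.{v} C] {J : GrothendieckTopology C}

/-- The reversed spans. -/
def Crible.reverse {X Y : C} (R : Crible X Y) : Crible Y X where
  rel f g := R.rel g f
  precomp h _ _ hfg := R.precomp h hfg

def ClosedCrible.reverse {X Y : C} (R : ClosedCrible J X Y) : ClosedCrible J Y X where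
  crible := R.crible.reverse
  isClosed _ f g T hT H := R.isClosed g f T hT H

namespace CribleQuantaloid

/-- The involution on the quantaloid of closed cribles which reverses all spans. -/
def involution (J : GrothendieckTopology C) : Involution (CribleQuantaloid J) where
  inv R := ClosedCrible.reverse R
  inv_id X := ClosedCrible.ext <| Crible.ext <| by
    funext W f g
    refine propext (exists_congr fun T => and_congr_right fun _ => forall₃_congr fun V k _ => ?_)
    exact eq_comm
  inv_comp R S := ClosedCrible.ext <| Crible.ext <| by
    funext W f g
    refine propext (exists_congr fun T => and_congr_right fun _ => forall₃_congr fun V k _ => ?_)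
    exact exists_congr fun _ => and_comm
  inv_sSup 𝓡 := ClosedCrible.ext <| Crible.ext <| by
    funext W f g
    refine propext (exists_congr fun T => and_congr_right fun _ => forall₃_congr fun V k _ => ?_)
    constructor
    · rintro ⟨_, ⟨R, hR, rfl⟩, h⟩
      exact ⟨_, ⟨_, ⟨R, hR, rfl⟩, rfl⟩, h⟩
    · rintro ⟨_, ⟨_, ⟨R, hR, rfl⟩, rfl⟩, h⟩
      exact ⟨_, ⟨R, hR, rfl⟩, h⟩
  inv_inv R := rfl

theorem le_iff {X Y : CribleQuantaloid J} {R S : X ⟶ Y} :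
    R ≤ S ↔ ∀ ⦃W : C⦄ (f : W ⟶ X.obj) (g : W ⟶ Y.obj), R.crible.rel f g → S.crible.rel f g :=
  Iff.rfl

theorem comp_le_iff {X Y Z : CribleQuantaloid J} {R : X ⟶ Y} {S : Y ⟶ Z} {T : X ⟶ Z} :
    R ≫ S ≤ T ↔ ∀ ⦃W : C⦄ (f : W ⟶ X.obj) (g : W ⟶ Y.obj) (h : W ⟶ Z.obj),
      R.crible.rel f g → S.crible.rel g h → T.crible.rel f h := by
  constructor
  · intro H W f g h hfg hgh
    exact H f h (Crible.le_close J _ _ _ ⟨g, hfg, hgh⟩)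
  · intro H
    refine Crible.close_le J T.isClosed ?_
    rintro W f h ⟨g, hfg, hgh⟩
    exact H f g h hfg hgh

theorem id_le_iff {X : CribleQuantaloid J} {R : X ⟶ X} :
    𝟙 X ≤ R ↔ R.crible.rel (𝟙 X.obj) (𝟙 X.obj) := by
  constructor
  · intro H
    exact H _ _ (Crible.le_close J _ _ _ rfl)
  · intro H
    refine Crible.close_le J R.isClosed ?_
    rintro W f _ rfl
    simpa using R.crible.precomp f H

/-- The graph of a morphism, as a closed crible. -/
def graph (J : GrothendieckTopology C) {X Y : C} (h : X ⟶ Y) :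
    (⟨X⟩ : CribleQuantaloid J) ⟶ ⟨Y⟩ where
  crible := Crible.close J
    { rel := fun a b => a ≫ h = b
      precomp := fun k a b hab => by rw [Category.assoc, hab] }
  isClosed := Crible.close_isClosed J _

theorem graph_rel_id {X Y : C} (h : X ⟶ Y) : (graph J h).crible.rel (𝟙 X) h :=
  Crible.le_close J _ _ _ (Category.id_comp h)

/-- The closed crible which is generated by a span. -/
theorem graph_inv_comp_graph_le_iff {X Y Z : C} (f : Z ⟶ X) (g : Z ⟶ Y)
    {R : (⟨X⟩ : CribleQuantaloid J) ⟶ ⟨Y⟩} :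
    (involution J).inv (graph J f) ≫ graph J g ≤ R ↔ R.crible.rel f g := by
  rw [comp_le_iff]
  constructor
  · intro H
    refine H f (𝟙 Z) g ?_ ?_
    · exact graph_rel_id f
    · exact graph_rel_id g
  · rintro H W a c b ⟨T, hT, h1⟩ ⟨T', hT', h2⟩
    refine R.isClosed _ _ _ (J.intersection_covering hT hT') ?_
    intro V k hk
    have h1 : (k ≫ c) ≫ f = k ≫ a := h1 k hk.1
    have h2 : (k ≫ c) ≫ g = k ≫ b := h2 k hk.2
    rw [← h1, ← h2]
    exact R.crible.precomp _ H

theorem isMap_graph {X Y : C} (h : X ⟶ Y) : (involution J).IsMap (graph J h) := by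
  constructor
  · rw [id_le_iff]
    exact Crible.le_close J _ _ _ ⟨h, graph_rel_id h, graph_rel_id h⟩
  · rw [graph_inv_comp_graph_le_iff]
    exact Crible.le_close J _ _ _ rfl

theorem sSup_rel {X Y : CribleQuantaloid J} {S : Set (X ⟶ Y)} {W : C} {f : W ⟶ X.obj}
    {g : W ⟶ Y.obj} : (sSup S).crible.rel f g ↔ ∃ T ∈ J W, ∀ ⦃V : C⦄ (k : V ⟶ W), T k →
      ∃ R ∈ S, R.crible.rel (k ≫ f) (k ≫ g) := by
  refine exists_congr fun T => and_congr_right fun _ => forall₃_congr fun V k _ => ?_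
  constructor
  · rintro ⟨_, ⟨R, hR, rfl⟩, h⟩
    exact ⟨R, hR, h⟩
  · rintro ⟨R, hR, h⟩
    exact ⟨_, ⟨R, hR, rfl⟩, h⟩

end CribleQuantaloid

end CribleInvolution

/-- A span lies in a closed crible exactly when the composite of its graphs lies below it, so
testing on graphs suffices. Locality comes from the closures: one covering sieve for the supremum,
another for the composite. -/
theorem CribleQuantaloid.involution_isTabular {C : Type u} [SmallCategory C]
    (J : GrothendieckTopology C) : (involution J).IsTabular where
  le_of_span_le {X Y} q r H := by
    rw [le_iff]
    intro W f g hfg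
    rw [← graph_inv_comp_graph_le_iff]
    exact H ⟨W⟩ _ _ (isMap_graph f) (isMap_graph g) ((graph_inv_comp_graph_le_iff f g).2 hfg)
  id_le_of_local {V I} Y p q hpq r H := by
    rw [id_le_iff] at hpq ⊢
    obtain ⟨T, hT, h⟩ := sSup_rel.1 hpq
    refine r.isClosed _ _ T hT fun U k hk => ?_
    obtain ⟨_, ⟨i, rfl⟩, T', hT', h'⟩ := h k hk
    refine r.isClosed _ _ T' hT' fun U' k' hk' => ?_
    obtain ⟨m, h1, h2⟩ := h' k' hk'
    simp only [Category.comp_id] at h1 h2 ⊢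
    rw [← graph_inv_comp_graph_le_iff]
    exact H i ⟨U'⟩ _ (graph J m) (isMap_graph _) (isMap_graph _)
      ((graph_inv_comp_graph_le_iff _ _).2 h1) ((graph_inv_comp_graph_le_iff _ _).2 h2)

/-! ### Tabular quantaloids are quantaloids of closed cribles -/

namespace Quantaloid.Involution

variable {Q : Type u} [Quantaloid.{u} Q] (ι : Involution Q)

/-- The category of maps: it has the objects of `Q` as objects. -/
structure MapCat (ι : Involution Q) where
  obj : Q

instance : SmallCategory ι.MapCat where
  Hom X Y := {f : X.obj ⟶ Y.obj // ι.IsMap f}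
  id X := ⟨𝟙 X.obj, isMap_id _⟩
  comp f g := ⟨f.1 ≫ g.1, f.2.comp g.2⟩
  id_comp f := Subtype.ext (Category.id_comp f.1)
  comp_id f := Subtype.ext (Category.comp_id f.1)
  assoc f g h := Subtype.ext (Category.assoc f.1 g.1 h.1)

variable {ι}

def MapCat.arrow {X Y : ι.MapCat} (f : X ⟶ Y) : X.obj ⟶ Y.obj := f.1

def MapCat.homMk {X Y : ι.MapCat} (f : X.obj ⟶ Y.obj) (hf : ι.IsMap f) : X ⟶ Y := ⟨f, hf⟩

namespace MapCat

theorem isMap {X Y : ι.MapCat} (f : X ⟶ Y) : ι.IsMap (arrow f) := f.2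

theorem hom_ext {X Y : ι.MapCat} {f g : X ⟶ Y} (h : arrow f = arrow g) : f = g := Subtype.ext h

theorem arrow_homMk {X Y : ι.MapCat} (f : X.obj ⟶ Y.obj) (hf : ι.IsMap f) :
    arrow (homMk f hf) = f := rfl

theorem arrow_comp {X Y Z : ι.MapCat} (f : X ⟶ Y) (g : Y ⟶ Z) :
    arrow (f ≫ g) = arrow f ≫ arrow g := rfl

theorem arrow_id (X : ι.MapCat) : arrow (𝟙 X) = 𝟙 X.obj := rfl

/-- The subidentity which is covered by the members of a sieve. -/
def support {W : ι.MapCat} (S : Sieve W) : W.obj ⟶ W.obj :=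
  ⨆ s : (Σ V : ι.MapCat, {k : V ⟶ W // S k}), ι.inv (arrow s.2.1) ≫ arrow s.2.1

theorem le_support {V W : ι.MapCat} {S : Sieve W} {k : V ⟶ W} (hk : S k) :
    ι.inv (arrow k) ≫ arrow k ≤ support S :=
  le_iSup (fun s : (Σ V : ι.MapCat, {k : V ⟶ W // S k}) => ι.inv (arrow s.2.1) ≫ arrow s.2.1)
    ⟨V, k, hk⟩

theorem support_le_iff {W : ι.MapCat} {S : Sieve W} {r : W.obj ⟶ W.obj} :
    support S ≤ r ↔ ∀ ⦃V : ι.MapCat⦄ (k : V ⟶ W), S k → ι.inv (arrow k) ≫ arrow k ≤ r :=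
  ⟨fun h _ _ hk => (le_support hk).trans h, fun h => iSup_le fun s => h s.2.1 s.2.2⟩

/-- The topology on the category of maps: a sieve covers when the identity is the supremum of the
subidentities given by its members. -/
def topology (h : ι.IsTabular) : GrothendieckTopology ι.MapCat where
  sieves W := {S | 𝟙 W.obj ≤ support S}
  top_mem' W := by
    refine le_trans ?_ (le_support (k := 𝟙 W) (S := ⊤) trivial)
    simp [arrow_id, ι.inv_id]
  pullback_stable' W V S f hS := by
    change 𝟙 W.obj ≤ support S at hS
    -- The cospan f, s replaces a pullback: a test span (k, m) below f ≫ s° is a commutative square,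
    -- so k ≫ f factors through s ∈ S.
    refine h.id_le_of_local (I := Σ V : ι.MapCat, {k : V ⟶ W // S k}) (fun s => s.1.obj)
      (fun s => arrow f ≫ ι.inv (arrow s.2.1)) (fun s => arrow s.2.1 ≫ ι.inv (arrow f)) ?_ _ ?_
    · calc 𝟙 V.obj ≤ arrow f ≫ ι.inv (arrow f) := (isMap f).1
        _ = arrow f ≫ 𝟙 _ ≫ ι.inv (arrow f) := by simp
        _ ≤ arrow f ≫ support S ≫ ι.inv (arrow f) := by gcongr
        _ = _ := by
          unfold support
          simp only [Quantaloid.iSup_comp, Quantaloid.comp_iSup, Category.assoc]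
    · rintro ⟨Y, s, hs⟩ U k m hk hm h1 -
      refine le_support (V := ⟨U⟩) (k := homMk k hk) ?_
      rw [hk.span_le_cospan_iff hm (isMap f) (isMap s)] at h1
      have : homMk (X := ⟨U⟩) k hk ≫ f = homMk (X := ⟨U⟩) m hm ≫ s := hom_ext h1
      change S (homMk (X := ⟨U⟩) k hk ≫ f)
      rw [this]
      exact S.downward_closed hs _
  transitive' W S hS R hR := by
    change 𝟙 W.obj ≤ support R
    refine le_trans hS (support_le_iff.2 fun V k hk => ?_)
    have h1 : 𝟙 V.obj ≤ support (R.pullback k) := hR hk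
    calc ι.inv (arrow k) ≫ arrow k = ι.inv (arrow k) ≫ 𝟙 V.obj ≫ arrow k := by simp
      _ ≤ ι.inv (arrow k) ≫ support (R.pullback k) ≫ arrow k := by gcongr
      _ ≤ support R := by
        rw [IsAdj.comp_le_iff (isMap k), IsAdj.comp_right_le_iff (isMap k), support_le_iff]
        intro U l hl
        rw [← IsAdj.comp_right_le_iff (isMap k), ← IsAdj.comp_le_iff (isMap k)]
        simpa [arrow_comp, ι.inv_comp] using le_support (k := l ≫ k) hl

theorem mem_topology_iff (h : ι.IsTabular) {W : ι.MapCat} {S : Sieve W} :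
    S ∈ topology h W ↔ 𝟙 W.obj ≤ support S := Iff.rfl

variable (h : ι.IsTabular)

/-- The spans of maps which lie below a given morphism. -/
def spans {X Y : ι.MapCat} (q : X.obj ⟶ Y.obj) : ClosedCrible (topology h) X Y where
  crible :=
    { rel := fun f g => ι.inv (arrow f) ≫ arrow g ≤ q
      precomp := fun {V W} k f g hfg => by
        rw [arrow_comp, arrow_comp, ι.inv_comp, Category.assoc, IsAdj.comp_le_iff (isMap f),
          IsAdj.comp_le_iff (isMap k)]
        gcongr
        rwa [← IsAdj.comp_le_iff (isMap f)] }
  isClosed W f g T hT H := by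
    rw [mem_topology_iff] at hT
    change ι.inv (arrow f) ≫ arrow g ≤ q
    calc ι.inv (arrow f) ≫ arrow g = ι.inv (arrow f) ≫ 𝟙 _ ≫ arrow g := by simp
      _ ≤ ι.inv (arrow f) ≫ support T ≫ arrow g := by gcongr
      _ ≤ q := ?_
    rw [IsAdj.comp_le_iff (isMap f), IsAdj.comp_right_le_iff (isMap g), support_le_iff]
    intro U k hk
    rw [← IsAdj.comp_right_le_iff (isMap g), ← IsAdj.comp_le_iff (isMap f)]
    simpa [arrow_comp, ι.inv_comp] using H k hk

theorem spans_rel {X Y W : ι.MapCat} {q : X.obj ⟶ Y.obj} {f : W ⟶ X} {g : W ⟶ Y} :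
    (spans h q).crible.rel f g ↔ ι.inv (arrow f) ≫ arrow g ≤ q := Iff.rfl

theorem spans_le_spans_iff {X Y : ι.MapCat} {q r : X.obj ⟶ Y.obj} :
    spans h q ≤ spans h r ↔ q ≤ r := by
  constructor
  · intro H
    exact h.le_of_span_le q r fun Z f g hf hg => H (W := ⟨Z⟩) (homMk f hf) (homMk g hg)
  · intro H W f g hfg
    exact le_trans hfg H

theorem spans_id (X : Q) : spans h (X := ⟨X⟩) (Y := ⟨X⟩) (𝟙 X) =
    𝟙 (⟨⟨X⟩⟩ : CribleQuantaloid (topology h)) := by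
  apply le_antisymm
  · intro W f g hfg
    rw [spans_rel, IsAdj.comp_le_iff (isMap f), Category.comp_id] at hfg
    exact Crible.le_close _ _ _ _ (hom_ext ((isMap g).eq_of_le (isMap f) hfg)).symm
  · rw [CribleQuantaloid.id_le_iff, spans_rel]
    simp [arrow_id, ι.inv_id]

/-- Composites of cribles require an actual middle leg. For a span below p ≫ q, tabularity provides
one locally, and the closure needs no more. -/
theorem spans_comp {X Y Z : Q} (p : X ⟶ Y) (q : Y ⟶ Z) :
    spans h (X := ⟨X⟩) (Y := ⟨Z⟩) (p ≫ q) =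
    (show (⟨⟨X⟩⟩ : CribleQuantaloid (topology h)) ⟶ ⟨⟨Y⟩⟩ from spans h p) ≫
      (show (⟨⟨Y⟩⟩ : CribleQuantaloid (topology h)) ⟶ ⟨⟨Z⟩⟩ from spans h q) := by
  apply le_antisymm
  · intro W f g hfg
    rw [spans_rel, IsAdj.comp_le_iff (isMap f)] at hfg
    let S : Sieve W :=
      { arrows := fun V k => ∃ m : V ⟶ (⟨Y⟩ : ι.MapCat),
          (spans h (X := ⟨X⟩) p).crible.rel (k ≫ f) m ∧
          (spans h (Y := ⟨Z⟩) q).crible.rel m (k ≫ g)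
        downward_closed := by
          rintro V U k ⟨m, h1, h2⟩ l
          refine ⟨l ≫ m, ?_, ?_⟩
          · simpa using (spans h (X := ⟨X⟩) p).crible.precomp l h1
          · simpa using (spans h (Y := ⟨Z⟩) q).crible.precomp l h2 }
    refine ⟨S, ?_, fun V k hk => hk⟩
    -- Here 1 ≤ g ≫ g° ≤ (f ≫ p) ≫ (q ≫ g°), a single composite through `Y`.
    refine h.id_le_of_local (I := PUnit) (fun _ => Y) (fun _ => arrow f ≫ p)
      (fun _ => q ≫ ι.inv (arrow g)) ?_ _ ?_
    · rw [iSup_const, Category.assoc, ← Category.assoc p, ← Category.assoc]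
      refine (isMap g).1.trans ?_
      gcongr
    · intro _ U k m hk hm h1 h2
      refine le_support (V := ⟨U⟩) (k := homMk k hk) ⟨homMk m hm, ?_, ?_⟩
      · rw [spans_rel, arrow_comp, arrow_homMk, arrow_homMk, ι.inv_comp, Category.assoc,
          IsAdj.comp_le_iff (isMap f)]
        exact h1
      · rw [spans_rel, arrow_comp, arrow_homMk, arrow_homMk, ← Category.assoc,
          IsAdj.comp_right_le_iff (isMap g)]
        exact h2
  · rw [CribleQuantaloid.comp_le_iff]
    intro W a b c hab hbc
    have hab : ι.inv (arrow a) ≫ arrow b ≤ p := hab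
    have hbc : ι.inv (arrow b) ≫ arrow c ≤ q := hbc
    change ι.inv (arrow a) ≫ arrow c ≤ p ≫ q
    calc ι.inv (arrow a) ≫ arrow c = ι.inv (arrow a) ≫ 𝟙 _ ≫ arrow c := by simp
      _ ≤ ι.inv (arrow a) ≫ (arrow b ≫ ι.inv (arrow b)) ≫ arrow c := by
        gcongr
        exact (isMap b).1
      _ = (ι.inv (arrow a) ≫ arrow b) ≫ ι.inv (arrow b) ≫ arrow c := by simp
      _ ≤ p ≫ q := by gcongr

/-- Every closed crible consists of the spans below the supremum of its members. -/
theorem exists_spans_eq {X Y : ι.MapCat} (R : ClosedCrible (topology h) X Y) :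
    ∃ q : X.obj ⟶ Y.obj, spans h q = R := by
  let I := Σ V : ι.MapCat, {s : (V ⟶ X) × (V ⟶ Y) // R.crible.rel s.1 s.2}
  refine ⟨⨆ s : I, ι.inv (arrow s.2.1.1) ≫ arrow s.2.1.2, le_antisymm ?_ ?_⟩
  · intro W f g hfg
    rw [spans_rel, IsAdj.comp_le_iff (isMap f)] at hfg
    let S : Sieve W :=
      { arrows := fun V k => R.crible.rel (k ≫ f) (k ≫ g)
        downward_closed := by
          intro V U k hk l
          simpa using R.crible.precomp l hk }
    refine R.isClosed f g S ?_ fun V k hk => hk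
    refine h.id_le_of_local (I := I) (fun s => s.1.obj)
      (fun s => arrow f ≫ ι.inv (arrow s.2.1.1)) (fun s => arrow s.2.1.2 ≫ ι.inv (arrow g)) ?_ _ ?_
    · have h1 := (isMap g).1.trans (comp_mono hfg le_rfl)
      refine h1.trans (le_of_eq ?_)
      simp only [Quantaloid.iSup_comp, Quantaloid.comp_iSup, Category.assoc]
    · rintro ⟨V, ⟨a, b⟩, hab⟩ U k m hk hm h1 h2
      -- Both test inequalities are commutative squares, so the restriction of (f, g) along k is
      -- that of the member (a, b) of R along m.
      have h3 : homMk (X := ⟨U⟩) k hk ≫ f = homMk (X := ⟨U⟩) m hm ≫ a :=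
        hom_ext ((hk.span_le_cospan_iff hm (isMap f) (isMap a)).1 h1)
      have h4 : homMk (X := ⟨U⟩) k hk ≫ g = homMk (X := ⟨U⟩) m hm ≫ b :=
        hom_ext ((hm.span_le_cospan_iff hk (isMap b) (isMap g)).1 h2).symm
      refine le_support (V := ⟨U⟩) (k := homMk k hk) ?_
      change R.crible.rel (homMk (X := ⟨U⟩) k hk ≫ f) (homMk (X := ⟨U⟩) k hk ≫ g)
      rw [h3, h4]
      exact R.crible.precomp _ hab
  · intro W f g hfg
    exact le_iSup (fun s : I => ι.inv (arrow s.2.1.1) ≫ arrow s.2.1.2) ⟨W, ⟨f, g⟩, hfg⟩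

/-- The representation of a tabular quantaloid by closed cribles. -/
def representation : Homomorphism Q (CribleQuantaloid (topology h)) where
  obj X := ⟨⟨X⟩⟩
  map q := spans h q
  map_id := spans_id h
  map_comp := spans_comp h
  map_sSup {X Y} S := by
    apply le_antisymm
    · obtain ⟨q, hq⟩ := exists_spans_eq h (X := ⟨X⟩) (Y := ⟨Y⟩)
        (sSup ((fun q : X ⟶ Y => spans h (X := ⟨X⟩) (Y := ⟨Y⟩) q) '' S))
      refine le_trans ?_ hq.le
      refine (spans_le_spans_iff h).2 (sSup_le fun p hp => (spans_le_spans_iff h).1 ?_)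
      rw [hq]
      exact le_sSup ⟨p, hp, rfl⟩
    · refine sSup_le ?_
      rintro _ ⟨p, hp, rfl⟩
      exact (spans_le_spans_iff h).2 (le_sSup hp)

theorem representation_isEquivalence : (representation h).IsEquivalence := by
  have : (representation h).Full := ⟨fun R => exists_spans_eq h R⟩
  have : (representation h).Faithful := ⟨fun {X Y q r} hqr =>
    le_antisymm ((spans_le_spans_iff h (X := ⟨X⟩) (Y := ⟨Y⟩)).1 hqr.le)
      ((spans_le_spans_iff h (X := ⟨X⟩) (Y := ⟨Y⟩)).1 hqr.ge)⟩
  exact (representation h).isEquivalence_of_iso (fun Y => Y.obj.obj) fun Y => Iso.refl Y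

end MapCat

theorem IsTabular.isSmallQuantaloidOfClosedCribles (h : ι.IsTabular) :
    IsSmallQuantaloidOfClosedCribles Q :=
  ⟨ι.MapCat, inferInstance, MapCat.topology h, MapCat.representation h,
    MapCat.representation_isEquivalence h⟩

end Quantaloid.Involution

/-! ### Splitting symmetric idempotents -/

namespace IdempotentClass

variable {Q : Type u} [Quantaloid.{u} Q] {E : IdempotentClass Q} {ι : Involution Q}
  (hE : E.IsSymmetric ι) (hid : E.ContainsIdentities)

instance : (inclusion hE hid).Full :=
  ⟨fun x => ⟨x.val, rfl⟩⟩

instance : (inclusion hE hid).Faithful :=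
  ⟨fun h => congrArg SplitHom.val h⟩

/-- In a tabular quantaloid, every split symmetric idempotent is covered by maps. -/
theorem inclusion_isDense (h : ι.IsTabular) : (inclusion hE hid).IsDense := by
  intro Z
  have hs : ι.inv Z.e = Z.e := hE _ _ Z.mem
  have hi : Z.e ≫ Z.e = Z.e := E.idem _ Z.mem
  obtain ⟨r, hr⟩ : ∃ r, r = ⨆ k : (inclusion hE hid).MapInto Z,
    (splitInvolution hE).inv k.map ≫ k.map := ⟨_, rfl⟩
  rw [← hr]
  change Z.e ≤ r.val
  refine h.le_of_span_le _ _ fun A f g hf hg hfg => ?_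
  have hgf : ι.inv g ≫ f ≤ Z.e := by
    have := ι.inv_mono hfg
    rwa [ι.inv_comp, ι.inv_inv, hs] at this
  -- Going along the span and back gives f° ≫ f ≤ (f° ≫ g) ≫ (g° ≫ f) ≤ e ≫ e; this is where
  -- symmetry and idempotence of e combine.
  have hff : ι.inv f ≫ f ≤ Z.e := by
    calc ι.inv f ≫ f = ι.inv f ≫ 𝟙 A ≫ f := by simp
      _ ≤ ι.inv f ≫ (g ≫ ι.inv g) ≫ f := by gcongr; exact hg.1
      _ = (ι.inv f ≫ g) ≫ ι.inv g ≫ f := by simp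
      _ ≤ Z.e ≫ Z.e := by gcongr
      _ = Z.e := hi
  have hff' : 𝟙 A ≤ f ≫ Z.e ≫ ι.inv f := by
    rw [← Category.assoc, ← IsAdj.comp_right_le_iff hf, ← IsAdj.comp_le_iff hf, Category.id_comp]
    exact hff
  have hfe : (f ≫ Z.e) ≫ Z.e = f ≫ Z.e := by rw [Category.assoc, hi]
  let k : (inclusion hE hid).obj A ⟶ Z := ⟨f ≫ Z.e, hfe, Category.id_comp _⟩
  have hk : (splitInvolution hE).IsMap k := by
    constructor
    · change 𝟙 A ≤ (f ≫ Z.e) ≫ ι.inv (f ≫ Z.e)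
      rw [ι.inv_comp, hs, Category.assoc, ← Category.assoc Z.e, hi]
      exact hff'
    · change ι.inv (f ≫ Z.e) ≫ f ≫ Z.e ≤ Z.e
      calc ι.inv (f ≫ Z.e) ≫ f ≫ Z.e = Z.e ≫ (ι.inv f ≫ f) ≫ Z.e := by
            rw [ι.inv_comp, hs]; simp
        _ ≤ Z.e ≫ Z.e ≫ Z.e := by gcongr
        _ = Z.e := by rw [hi, hi]
  have hkr : (splitInvolution hE).inv k ≫ k ≤ r := by
    rw [hr]
    exact le_iSup (fun k : (inclusion hE hid).MapInto Z => (splitInvolution hE).inv k.map ≫ k.map)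
      ⟨A, k, hk⟩
  have hkr : ι.inv (f ≫ Z.e) ≫ f ≫ Z.e ≤ r.val := hkr
  -- Both legs of the span lie below k = f ≫ e, hence f° ≫ g ≤ k° ≫ k.
  have hg' : g ≤ f ≫ Z.e := (IsAdj.comp_le_iff hf).1 hfg
  have hf' : f ≤ g ≫ Z.e := (IsAdj.comp_le_iff hg).1 hgf
  refine le_trans (comp_mono (ι.inv_mono ?_) hg') hkr
  calc f ≤ g ≫ Z.e := hf'
    _ ≤ (f ≫ Z.e) ≫ Z.e := by gcongr
    _ = f ≫ Z.e := hfe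

end IdempotentClass

/-! ### Change of base -/

namespace SymDist

variable {Q R : Type u} [Quantaloid.{u} Q] [Quantaloid.{u} R] {ι : Involution Q}
  {κ : Involution R} (F : InvHomomorphism ι κ) [F.Full] [F.Faithful]

instance : (changeOfBase F).Full :=
  ⟨fun {A B} Φ => by
    let φ : ∀ (x : A.ob) (y : B.ob), F.obj (A.ty x) ⟶ F.obj (B.ty y) := Distributor.app Φ
    have h1 : ∀ x y y', φ x y ≫ F.map (B.hom y y') ≤ φ x y' := Distributor.app_hom_le Φ
    have h2 : ∀ x' x y, F.map (A.hom x' x) ≫ φ x y ≤ φ x' y := Distributor.hom_app_le Φ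
    refine ⟨{ app := fun x y => F.preimage (φ x y), app_hom_le := ?_, hom_app_le := ?_ },
      Distributor.ext ?_⟩
    · intro x y y'
      rw [← F.map_le_map_iff, F.map_comp, F.map_preimage, F.map_preimage]
      exact h1 x y y'
    · intro x' x y
      rw [← F.map_le_map_iff, F.map_comp, F.map_preimage, F.map_preimage]
      exact h2 x' x y
    · funext x y
      exact F.map_preimage (φ x y)⟩

instance : (changeOfBase F).Faithful :=
  ⟨fun {A B Φ Ψ} h => Distributor.ext <| by
    funext x y
    exact F.map_injective (congrFun₂ (congrArg Distributor.app h) x y)⟩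

/-- The resolution of a symmetric `R`-category by all maps into its types from objects in the image
of `F`. -/
noncomputable def resolution (A : SymDist κ) : SymDist ι where
  ob := Σ x : A.ob, F.MapInto (A.ty x)
  ty x := x.2.dom
  hom x y := F.preimage (x.2.map ≫ A.hom x.1 y.1 ≫ κ.inv y.2.map)
  id_le x := by
    rw [← F.map_le_map_iff, F.map_id, F.map_preimage]
    refine x.2.isMap.1.trans ?_
    gcongr
    simpa using comp_mono (A.id_le x.1) (le_refl (κ.inv x.2.map))
  comp_le x y z := by
    rw [← F.map_le_map_iff, F.map_comp, F.map_preimage, F.map_preimage, F.map_preimage]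
    calc (x.2.map ≫ A.hom x.1 y.1 ≫ κ.inv y.2.map) ≫ y.2.map ≫ A.hom y.1 z.1 ≫ κ.inv z.2.map
        = x.2.map ≫ A.hom x.1 y.1 ≫ (κ.inv y.2.map ≫ y.2.map) ≫ A.hom y.1 z.1 ≫
            κ.inv z.2.map := by simp
      _ ≤ x.2.map ≫ A.hom x.1 y.1 ≫ 𝟙 _ ≫ A.hom y.1 z.1 ≫ κ.inv z.2.map := by
        gcongr
        exact y.2.isMap.2
      _ = x.2.map ≫ (A.hom x.1 y.1 ≫ A.hom y.1 z.1) ≫ κ.inv z.2.map := by simp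
      _ ≤ x.2.map ≫ A.hom x.1 z.1 ≫ κ.inv z.2.map := by
        gcongr
        exact A.comp_le _ _ _
  symm x y := F.map_injective <| by
    rw [F.map_inv, F.map_preimage, F.map_preimage, κ.inv_comp, κ.inv_comp, κ.inv_inv, A.symm,
      Category.assoc]

/-- The comparison distributor from the resolution of `A` to `A`. -/
noncomputable def resolutionHom (A : SymDist κ) : (changeOfBase F).obj (resolution F A) ⟶ A where
  app x y := x.2.map ≫ A.hom x.1 y
  app_hom_le x y y' := by
    refine (Category.assoc _ _ _).le.trans (comp_mono le_rfl ?_)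
    exact A.comp_le _ _ _
  hom_app_le x' x y := by
    refine (comp_mono (F.map_preimage _).le le_rfl).trans ?_
    calc (x'.2.map ≫ A.hom x'.1 x.1 ≫ κ.inv x.2.map) ≫ x.2.map ≫ A.hom x.1 y
        = x'.2.map ≫ A.hom x'.1 x.1 ≫ (κ.inv x.2.map ≫ x.2.map) ≫ A.hom x.1 y := by simp
      _ ≤ x'.2.map ≫ A.hom x'.1 x.1 ≫ 𝟙 _ ≫ A.hom x.1 y := by
        gcongr
        exact x.2.isMap.2
      _ = x'.2.map ≫ A.hom x'.1 x.1 ≫ A.hom x.1 y := by simp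
      _ ≤ x'.2.map ≫ A.hom x'.1 y := by
        gcongr
        exact A.comp_le _ _ _

theorem iSup_hom_comp_hom (A : SymDist κ) (x z : A.ob) :
    ⨆ y, A.hom x y ≫ A.hom y z = A.hom x z :=
  congrArg (fun Φ => Distributor.app Φ x z) (Distributor.id_comp (Distributor.id A.toQCat))

/-- The supremum runs over objects of `A`, so A ⊗ A = A suffices and density plays no role. -/
theorem resolutionHom_comp_involute (A : SymDist κ) :
    resolutionHom F A ≫ (involution κ).inv (resolutionHom F A) = 𝟙 _ :=
  Distributor.ext <| by
    funext x z
    change ⨆ y, (x.2.map ≫ A.hom x.1 y) ≫ κ.inv (z.2.map ≫ A.hom z.1 y) =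
      F.map (F.preimage (x.2.map ≫ A.hom x.1 z.1 ≫ κ.inv z.2.map))
    rw [F.map_preimage, ← iSup_hom_comp_hom A x.1 z.1, Quantaloid.iSup_comp, Quantaloid.comp_iSup]
    refine iSup_congr fun y => ?_
    rw [κ.inv_comp, A.symm]
    simp

/-- The supremum also runs over the maps k into each type; by density the factors k° ≫ k join to the
identity, which leaves A ⊗ A = A. -/
theorem involute_comp_resolutionHom (hF : F.IsDense) (A : SymDist κ) :
    (involution κ).inv (resolutionHom F A) ≫ resolutionHom F A = 𝟙 _ :=
  Distributor.ext <| by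
    funext x z
    change ⨆ y : (Σ x : A.ob, F.MapInto (A.ty x)),
      κ.inv (y.2.map ≫ A.hom y.1 x) ≫ y.2.map ≫ A.hom y.1 z = A.hom x z
    rw [iSup_sigma, ← iSup_hom_comp_hom A x z]
    refine iSup_congr fun y => ?_
    rw [← hF.iSup_comp_comp]
    refine iSup_congr fun k => ?_
    rw [κ.inv_comp, A.symm]

/-- Change of base along a dense fully faithful homomorphism is an equivalence. -/
theorem changeOfBase_isEquivalence (hF : F.IsDense) : (changeOfBase F).IsEquivalence :=
  (changeOfBase F).isEquivalence_of_symmetric_iso fun A =>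
    ⟨resolution F A, ⟨resolutionHom F A, (involution κ).inv (resolutionHom F A),
      resolutionHom_comp_involute F A, involute_comp_resolutionHom F hF A⟩, rfl⟩

end SymDist

/-! ### The theorem -/

theorem mainTheorem7 {Q : Type u} [Quantaloid.{u} Q]
    (hQ : IsSmallQuantaloidOfClosedCribles Q) :
    ∃ ι : Quantaloid.Involution Q, ι.IsCanonical ∧
      ∀ (E : IdempotentClass Q) (hE : E.IsSymmetric ι) (hid : E.ContainsIdentities),
        IsSmallQuantaloidOfClosedCribles E.Split ∧
        (IdempotentClass.splitInvolution hE).IsCanonical ∧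
        (SymDist.changeOfBase (IdempotentClass.inclusion hE hid)).IsEquivalence := by
  obtain ⟨C, _, J, F, hF⟩ := hQ
  obtain ⟨ι, hι⟩ := (CribleQuantaloid.involution_isTabular J).exists_of_equivalence F hF
  refine ⟨ι, hι.isCanonical, fun E hE hid => ?_⟩
  have hd := IdempotentClass.inclusion_isDense hE hid hι
  have ht := hd.isTabular hι
  exact ⟨ht.isSmallQuantaloidOfClosedCribles, ht.isCanonical,
    SymDist.changeOfBase_isEquivalence _ hd⟩
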